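/- Consider a sequence of stochastic block models with loops. The model with $N$ vertices has $M=M(N)\ge 1$ disjoint blocks of equal size $N/M\in\mathbb N$, where $N\to\infty$ and $M=o(N)$ (for example, $M$ constant). For every unordered pair $\{v,w\}$ of vertices, $v=w$ included, the edge $\{v,w\}$ is present independently of all others, with probability $p_m=p_m(N)\in[0,1]$ if $v$ and $w$ both lie in block $m$, and with probability $q=q(N)\in[0,1]$ if they lie in different blocks. Put $$\gamma_m=\frac NM p_m+(M-1)\frac NM q\quad(1\le m\le M),\qquad \gamma_{\min}=\min_m\gamma_m,\quad \gamma_{\max}=\max_m\gamma_m,\quad p_{\min}=\min_m p_m,\quad p_{\max}=\max_m p_m,$$ and suppose that $\gamma_{\min}>0$ for all large $N$. Assume the connectivity condition $$\frac{M\log^4 N}{Np_m+N(M-1)q}\cdot\frac{\gamma_{\max}^2}{\gamma_{\min}^2}\longrightarrow 0\qquad(N\to\infty)\quad\text{for all } m$$ (for every choice of a block $m=m(N)$), and the lower bound on $q$ $$\Big(\frac{M\log N}{N}\Big)^{1/4}p_{\min}^{5/4}\,p_{\max}^{1/2}=o\big(((M-1)q)^2\big).$$ For a realization of the graph let $d_v$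 be the degree of $v$ (a loop counts once), let $\pi_v=d_v/\sum_{u}d_u$, and let $H_{vw}$ be the expected number of steps that the simple random walk started in $v$ needs to reach $w$ (so $H_{vv}=0$; the walk moves in each step to a uniformly chosen neighbour). Let $H^v=\sum_w\pi_wH_{vw}$ be the hitting time from $v$ averaged over the target vertex. Then asymptotically almost surely the graph is connected and $H^v=N(1+o(1))$ for all vertices $v$; that is, for every $\delta>0$, $$\mathbb P\Big(\text{the graph is connected and } (1-\delta)N\le H^v\le(1+\delta)N\text{ for all }v\Big)\longrightarrow 1 .$$ -/

import Mathlib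

open MeasureTheory ProbabilityTheory Filter Topology Asymptotics
open scoped ENNReal

namespace SBM

noncomputable section

/-- Vertices of the stochastic block model with `M` blocks of `n` vertices each (so `N = M * n`
vertices in total): the vertex `v = (m, i)` is the `i`-th vertex of the block `m`. -/
abbrev Vertex (M n : ℕ) : Type := Fin M × Fin n

/-- Probability that the unordered pair `{v, w}` is an edge: `p m` if both ends are in block `m`
(in particular for a loop `{v, v}`), and `q` if the ends lie in different blocks. -/
def edgeProb {M n : ℕ} (p : Fin M → unitInterval) (q : unitInterval) :
    Sym2 (Vertex M n) → unitInterval :=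
  Sym2.lift ⟨fun v w => if v.1 = w.1 then p v.1 else q, by
    intro v w
    by_cases h : v.1 = w.1
    · simp [h]
    · simp [h, Ne.symm h]⟩

/-- Law of the stochastic block model on the set of graphs with loops on `Vertex M n`. A graph is
given by its edge indicators `ε : Sym2 (Vertex M n) → Bool`; these are independent, and
`ε e = true` has probability `edgeProb p q e`. -/
def law {M : ℕ} (n : ℕ) (p : Fin M → unitInterval) (q : unitInterval) :
    Measure (Sym2 (Vertex M n) → Bool) :=
  Measure.pi fun e => bernoulliMeasure true false (edgeProb p q e)

section Walk

variable {V : Type*} [Fintype V]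

/-- The neighbours of `v` in the graph with edge indicators `ε` (`v` itself is one of them if there
is a loop at `v`). -/
def neighbors (ε : Sym2 V → Bool) (v : V) : Finset V :=
  Finset.univ.filter fun w => ε s(v, w) = true

/-- The degree of `v`; a loop contributes one. -/
def degree (ε : Sym2 V → Bool) (v : V) : ℕ := (neighbors ε v).card

/-- The graph with edge indicators `ε` is connected. (Loops are irrelevant for this.) -/
def IsConnected (ε : Sym2 V → Bool) : Prop :=
  (SimpleGraph.fromEdgeSet {e | ε e = true}).Connected

/-- The invariant distribution `π v = d v / ∑ w, d w` of the simple random walk. -/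
def stationary (ε : Sym2 V → Bool) (v : V) : ℝ≥0∞ :=
  (degree ε v : ℝ≥0∞) / ∑ w, (degree ε w : ℝ≥0∞)

open Classical in
/-- One step of the simple random walk from `v`: a uniformly chosen neighbour. (By convention the
walk stays put at a vertex that has no neighbour.) -/
def step (ε : Sym2 V → Bool) (v : V) : PMF V :=
  if h : (neighbors ε v).Nonempty then PMF.uniformOfFinset (neighbors ε v) h else PMF.pure v

variable [MeasurableSpace V] [MeasurableSingletonClass V]

/-- The transition kernel of the simple random walk. -/
def stepKernel (ε : Sym2 V → Bool) : Kernel V V :=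
  Kernel.ofFunOfCountable fun v => (step ε v).toMeasure

instance (ε : Sym2 V → Bool) : IsMarkovKernel (stepKernel ε) :=
  ⟨fun v => inferInstanceAs (IsProbabilityMeasure (step ε v).toMeasure)⟩

/-- The conditional law of the position at time `t + 1` given the trajectory up to time `t`: it is
the step distribution from the position at time `t`. -/
def historyKernel (ε : Sym2 V → Bool) (t : ℕ) : Kernel ((i : Finset.Iic t) → V) V :=
  (stepKernel ε).comap (fun x => x ⟨t, Finset.mem_Iic.2 le_rfl⟩) (measurable_pi_apply _)

instance (ε : Sym2 V → Bool) (t : ℕ) : IsMarkovKernel (historyKernel ε t) := by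
  unfold historyKernel
  infer_instance

/-- The law, on the space `ℕ → V` of trajectories, of the simple random walk `X₀, X₁, …` started in
`X₀ = v`. -/
def walkLaw (ε : Sym2 V → Bool) (v : V) : Measure (ℕ → V) :=
  Kernel.trajMeasure (X := fun _ => V) (Measure.dirac v) (historyKernel ε)

/-- The first time `t ≥ 0` at which the trajectory `x` is in `w`, and `∞` if there is none. -/
def firstHit (w : V) (x : ℕ → V) : ℝ≥0∞ := ⨅ (t : ℕ) (_ : x t = w), (t : ℝ≥0∞)

/-- `H_{vw}`: the expected time that the walk started in `v` needs to reach `w`. -/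
def hittingTime (ε : Sym2 V → Bool) (v w : V) : ℝ≥0∞ := ∫⁻ x, firstHit w x ∂walkLaw ε v

/-- `H^v = ∑ w, π w * H_{vw}`: the hitting time from `v`, averaged over the target vertex. -/
def avgHittingTime (ε : Sym2 V → Bool) (v : V) : ℝ≥0∞ :=
  ∑ w, stationary ε w * hittingTime ε v w

end Walk

/-- The expected degree `γ_m = (N / M) p_m + (M - 1) (N / M) q` of a vertex in block `m`, where
`N / M = n`. -/
def expDegree {M : ℕ} (n : ℕ) (p : Fin M → unitInterval) (q : unitInterval) (m : Fin M) : ℝ :=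
  n * (p m : ℝ) + ((M : ℝ) - 1) * n * (q : ℝ)

end

end SBM

/-!
Let `c = (M - 1) (N / M) q` be the expected number of neighbours of a vertex outside its block. By
Cauchy–Schwarz over the blocks, a vertex set `S` with `2 |S| ≤ N` has at least `c |S| / 2` expected
edges to its complement. Chernoff's bound and a union bound over `S` show that asymptotically almost
surely all these cuts have at least `c |S| / 4` edges, while no degree exceeds `3 γ_max`. Such a
graph is connected, and by Cheeger's inequality its walk has a spectral gap of order
`(c / γ_max) ^ 2`.

The averaged hitting time `H ^ v` is obtained by solving the hitting equations with the inverse of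
`1 - B`, where `B` is the symmetrized transition matrix deprived of its top eigenvector. The average
is the trace of this inverse minus `1`, and the expansion `(1 - B)⁻¹ = 1 + B + B (1 - B)⁻¹ B` gives
`N - 2 ≤ H ^ v ≤ N (1 + O(1 / c + γ_max ^ 2 / c ^ 3))`. The connectivity condition and the lower
bound on `q` together force `γ_max ^ 2 log N = o(c ^ 3)`.
-/

namespace SBM

open scoped Finset

section WeightedGraph

variable {V : Type*} [Fintype V]

/-- The degree of `v` in the graph with edge weights `A`; a loop contributes its weight once. -/
def weightedDegree (A : Matrix V V ℝ) (v : V) : ℝ := ∑ w, A v w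

/-- The sum of all weighted degrees, i.e. the normalization of the invariant distribution of the
walk with edge weights `A`. -/
def totalWeight (A : Matrix V V ℝ) : ℝ := ∑ v, weightedDegree A v

/-- The Dirichlet form of the walk with edge weights `A`. The division by `2` makes each unordered
pair contribute once. -/
noncomputable def dirichletForm (A : Matrix V V ℝ) (f : V → ℝ) : ℝ :=
  (∑ v, ∑ w, A v w * (f v - f w) ^ 2) / 2

/-- The weighted degree matrix and the Laplacian of `A` satisfy the Poincaré inequality with
constant `g`: the second eigenvalue of the normalized Laplacian is at least `g`. -/
def HasSpectralGap (A : Matrix V V ℝ) (g : ℝ) : Prop :=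
  ∀ f : V → ℝ, ∑ v, weightedDegree A v * f v = 0 →
    g * ∑ v, weightedDegree A v * f v ^ 2 ≤ dirichletForm A f

variable {A : Matrix V V ℝ}

lemma weightedDegree_nonneg (hA₀ : ∀ v w, 0 ≤ A v w) (v : V) : 0 ≤ weightedDegree A v :=
  Finset.sum_nonneg fun w _ => hA₀ v w

lemma totalWeight_pos [Nonempty V] (hd : ∀ v, 0 < weightedDegree A v) : 0 < totalWeight A :=
  Finset.sum_pos (fun v _ => hd v) Finset.univ_nonempty

lemma dirichletForm_nonneg (hA₀ : ∀ v w, 0 ≤ A v w) (f : V → ℝ) : 0 ≤ dirichletForm A f :=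
  div_nonneg (Finset.sum_nonneg fun v _ => Finset.sum_nonneg fun w _ =>
    mul_nonneg (hA₀ v w) (sq_nonneg _)) zero_le_two

lemma dirichletForm_sub_const (f : V → ℝ) (c : ℝ) :
    dirichletForm A (fun v => f v - c) = dirichletForm A f := by
  simp only [dirichletForm, sub_sub_sub_cancel_right]

lemma sum_mul_apply_fst (φ : V → ℝ) :
    ∑ v, ∑ w, A v w * φ v = ∑ v, weightedDegree A v * φ v := by
  simp only [weightedDegree, Finset.sum_mul]

lemma sum_mul_swap_of_isSymm (hA : A.IsSymm) (F : V → V → ℝ) :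
    ∑ v, ∑ w, A v w * F w v = ∑ v, ∑ w, A v w * F v w := by
  rw [Finset.sum_comm]
  simp only [hA.apply]

lemma sum_mul_apply_snd (hA : A.IsSymm) (φ : V → ℝ) :
    ∑ v, ∑ w, A v w * φ w = ∑ v, weightedDegree A v * φ v := by
  rw [sum_mul_swap_of_isSymm hA fun v _ => φ v, sum_mul_apply_fst]

lemma sum_mul_add_sq_le (hA : A.IsSymm) (hA₀ : ∀ v w, 0 ≤ A v w) (f : V → ℝ) :
    ∑ v, ∑ w, A v w * (f v + f w) ^ 2 ≤ 4 * ∑ v, weightedDegree A v * f v ^ 2 := by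
  calc ∑ v, ∑ w, A v w * (f v + f w) ^ 2
      ≤ ∑ v, ∑ w, A v w * (2 * (f v ^ 2 + f w ^ 2)) := by
        gcongr with v _ w _
        · exact hA₀ v w
        · exact add_sq_le
    _ = 2 * (∑ v, ∑ w, A v w * f v ^ 2 + ∑ v, ∑ w, A v w * f w ^ 2) := by
        simp only [Finset.mul_sum, ← Finset.sum_add_distrib]
        exact Finset.sum_congr rfl fun v _ => Finset.sum_congr rfl fun w _ => by ring
    _ = 4 * ∑ v, weightedDegree A v * f v ^ 2 := by
        rw [sum_mul_apply_fst fun v => f v ^ 2, sum_mul_apply_snd hA fun v => f v ^ 2]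
        ring

lemma sq_sum_mul_abs_sq_sub_sq_le (hA₀ : ∀ v w, 0 ≤ A v w) (f : V → ℝ) :
    (∑ v, ∑ w, A v w * |f v ^ 2 - f w ^ 2|) ^ 2
      ≤ 2 * dirichletForm A f * ∑ v, ∑ w, A v w * (f v + f w) ^ 2 := by
  rw [dirichletForm, mul_div_cancel₀ _ two_ne_zero]
  simp only [← Finset.sum_product']
  refine Finset.sum_sq_le_sum_mul_sum_of_sq_le_mul _ (fun _ _ => ?_) (fun _ _ => ?_) fun _ _ => ?_
  · exact mul_nonneg (hA₀ _ _) (sq_nonneg _)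
  · exact mul_nonneg (hA₀ _ _) (sq_nonneg _)
  · rw [mul_pow, sq_abs]
    exact le_of_eq (by ring)

lemma sum_weightedDegree_mul_sub_sq (f : V → ℝ) (c : ℝ) :
    ∑ v, weightedDegree A v * (f v - c) ^ 2
      = ∑ v, weightedDegree A v * f v ^ 2 - 2 * c * ∑ v, weightedDegree A v * f v
        + c ^ 2 * totalWeight A := by
  simp only [totalWeight, Finset.mul_sum, ← Finset.sum_sub_distrib, ← Finset.sum_add_distrib]
  exact Finset.sum_congr rfl fun v _ => by ring

end WeightedGraph

section Cheeger

variable {V : Type*} [Fintype V] {A : Matrix V V ℝ}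

lemma exists_median {α : Type*} [LinearOrder α] [Nonempty V] (f : V → α) :
    ∃ v, 2 * #{w | f v < f w} ≤ Fintype.card V ∧ 2 * #{w | f w < f v} ≤ Fintype.card V := by
  classical
  have hne : ({v | 2 * #{w | f v < f w} ≤ Fintype.card V} : Finset V).Nonempty := by
    obtain ⟨v, -, hv⟩ := Finset.univ.exists_max_image f Finset.univ_nonempty
    have hempty : ({w | f v < f w} : Finset V) = ∅ :=
      Finset.filter_eq_empty_iff.2 fun w hw => (hv w hw).not_gt
    exact ⟨v, by simp [hempty]⟩
  obtain ⟨v, hv, hmin⟩ := Finset.exists_min_image _ f hne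
  refine ⟨v, by simpa using hv, ?_⟩
  rcases ({w | f w < f v} : Finset V).eq_empty_or_nonempty with hempty | hbelow
  · simp [hempty]
  obtain ⟨x, hx, hmax⟩ := Finset.exists_max_image _ f hbelow
  have hx_above : Fintype.card V < 2 * #{w | f x < f w} := by
    by_contra! h
    exact (hmin x (by simpa using h)).not_gt (by simpa using hx)
  have hdisj : Disjoint ({w | f w < f v} : Finset V) ({w | f x < f w} : Finset V) :=
    Finset.disjoint_left.2 fun w hw hw' => (hmax w hw).not_gt (by simpa using hw')
  have hcard := Finset.card_le_univ (({w | f w < f v} : Finset V) ∪ ({w | f x < f w} : Finset V))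
  rw [Finset.card_union_of_disjoint hdisj] at hcard
  lia

lemma integral_sum_mul_indicator_Ico {ι : Type*} (s : Finset ι) (c a b : ι → ℝ) :
    ∫ t, ∑ i ∈ s, c i * (Set.Ico (a i) (b i)).indicator 1 t = ∑ i ∈ s, c i * max (b i - a i) 0 := by
  rw [integral_finsetSum]
  · refine Finset.sum_congr rfl fun i _ => ?_
    rw [integral_const_mul, integral_indicator_one measurableSet_Ico, Real.volume_real_Ico]
  · intro i _
    exact ((integrable_indicator_iff measurableSet_Ico).2
      (integrableOn_const (by simp))).const_mul _

lemma integrable_sum_mul_indicator_Ico {ι : Type*} (s : Finset ι) (c a b : ι → ℝ) :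
    Integrable fun t => ∑ i ∈ s, c i * (Set.Ico (a i) (b i)).indicator (1 : ℝ → ℝ) t :=
  integrable_finsetSum _ fun _ _ => ((integrable_indicator_iff measurableSet_Ico).2
    (integrableOn_const (by simp))).const_mul _

lemma sum_mul_abs_sub (hA : A.IsSymm) (u : V → ℝ) :
    ∑ v, ∑ w, A v w * |u v - u w| = 2 * ∑ v, ∑ w, A v w * max (u v - u w) 0 := by
  have habs (x : ℝ) : |x| = max x 0 + max (-x) 0 := (posPart_add_negPart x).symm
  have hswap := sum_mul_swap_of_isSymm hA fun v w => max (u v - u w) 0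
  simp only [habs, neg_sub, mul_add, Finset.sum_add_distrib, hswap, two_mul]

lemma posPart_sub_sq_add_negPart_sub_sq_le (a b : ℝ) :
    (a⁺ - b⁺) ^ 2 + (a⁻ - b⁻) ^ 2 ≤ (a - b) ^ 2 := by
  rcases le_total a 0 with ha | ha <;> rcases le_total b 0 with hb | hb <;>
    simp only [posPart_eq_zero.2, posPart_eq_self.2, negPart_eq_zero.2, negPart_eq_neg.2, ha, hb]
      <;> nlinarith

lemma dirichletForm_posPart_add_negPart_le (hA₀ : ∀ v w, 0 ≤ A v w) (f : V → ℝ) :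
    dirichletForm A (fun v => (f v)⁺) + dirichletForm A (fun v => (f v)⁻) ≤ dirichletForm A f := by
  simp only [dirichletForm, ← add_div, ← Finset.sum_add_distrib, ← mul_add]
  gcongr with v _ w _
  · exact hA₀ v w
  · exact posPart_sub_sq_add_negPart_sub_sq_le _ _

lemma sq_eq_posPart_sq_add_negPart_sq (a : ℝ) : a ^ 2 = a⁺ ^ 2 + a⁻ ^ 2 := by
  rcases le_total a 0 with ha | ha <;> simp [ha]

variable [DecidableEq V]

/-- The total weight of the edges that leave `S`. -/
def cutWeight (A : Matrix V V ℝ) (S : Finset V) : ℝ := ∑ v ∈ S, ∑ w ∈ Sᶜ, A v w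

/-- Edge expansion with constant `h`: every set of at most half of the vertices is left by edges of
total weight at least `h` per vertex. -/
def IsExpanding (A : Matrix V V ℝ) (h : ℝ) : Prop :=
  ∀ S : Finset V, 2 * #S ≤ Fintype.card V → h * #S ≤ cutWeight A S

namespace IsExpanding

variable {h : ℝ}

lemma mul_sum_indicator_le (hexp : IsExpanding A h) {u : V → ℝ}
    (hu : ∀ v, 0 ≤ u v) (hsupp : 2 * #{v | 0 < u v} ≤ Fintype.card V) (t : ℝ) :
    ∑ v, h * (Set.Ico 0 (u v)).indicator (1 : ℝ → ℝ) t
      ≤ ∑ v, ∑ w, A v w * (Set.Ico (u w) (u v)).indicator (1 : ℝ → ℝ) t := by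
  rcases lt_or_ge t 0 with ht | ht
  · have hz (v w) : (Set.Ico (u w) (u v)).indicator (1 : ℝ → ℝ) t = 0 :=
      Set.indicator_of_notMem (fun h => (ht.trans_le (hu w)).not_ge h.1) _
    simp [hz, ht.not_ge]
  have hS : 2 * #{v | t < u v} ≤ Fintype.card V := by
    refine le_trans (Nat.mul_le_mul_left 2 (Finset.card_le_card fun v hv => ?_)) hsupp
    simpa using ht.trans_lt (by simpa using hv)
  refine le_trans (le_of_eq ?_) ((hexp {v | t < u v} hS).trans (le_of_eq ?_))
  · simp [Set.indicator_apply, ht, Finset.sum_ite, mul_comm]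
  · simp only [cutWeight, Finset.compl_filter, Finset.sum_filter, Set.indicator_apply, Set.mem_Ico,
      not_lt, Pi.one_apply, mul_ite, mul_one, mul_zero, ite_and]
    exact Finset.sum_congr rfl fun v _ => by split_ifs <;> simp

/-- The coarea inequality: integrate the expansion of the superlevel sets of `u` over all levels. -/
lemma mul_sum_le (hexp : IsExpanding A h) (hA : A.IsSymm) {u : V → ℝ} (hu : ∀ v, 0 ≤ u v)
    (hsupp : 2 * #{v | 0 < u v} ≤ Fintype.card V) :
    h * ∑ v, u v ≤ (∑ v, ∑ w, A v w * |u v - u w|) / 2 := by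
  have hlevels := integral_mono
    (integrable_sum_mul_indicator_Ico Finset.univ (fun _ => h) (fun _ => 0) u)
    (integrable_sum_mul_indicator_Ico (Finset.univ ×ˢ Finset.univ)
      (fun e : V × V => A e.1 e.2) (fun e => u e.2) (fun e => u e.1))
    fun t => by simpa only [Finset.sum_product] using hexp.mul_sum_indicator_le hu hsupp t
  simp only [integral_sum_mul_indicator_Ico] at hlevels
  simp only [Finset.sum_product, sub_zero, max_eq_left (hu _), ← Finset.mul_sum] at hlevels
  rwa [sum_mul_abs_sub hA, mul_div_cancel_left₀ _ two_ne_zero]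

lemma sq_mul_sum_sq_le (hexp : IsExpanding A h) (hA : A.IsSymm) (hA₀ : ∀ v w, 0 ≤ A v w)
    (hh : 0 ≤ h) {D : ℝ} (hD₀ : 0 ≤ D) (hD : ∀ v, weightedDegree A v ≤ D) {f : V → ℝ}
    (hf : ∀ v, 0 ≤ f v) (hsupp : 2 * #{v | 0 < f v} ≤ Fintype.card V) :
    h ^ 2 * ∑ v, f v ^ 2 ≤ 2 * D * dirichletForm A f := by
  have hE := dirichletForm_nonneg hA₀ f
  have hcoarea : h * ∑ v, f v ^ 2 ≤ (∑ v, ∑ w, A v w * |f v ^ 2 - f w ^ 2|) / 2 :=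
    hexp.mul_sum_le hA (fun v => sq_nonneg _)
      (by simpa only [sq_pos_iff, (hf _).lt_iff_ne'] using hsupp)
  have hdeg : ∑ v, weightedDegree A v * f v ^ 2 ≤ D * ∑ v, f v ^ 2 := by
    rw [Finset.mul_sum]
    gcongr with v
    exact hD v
  set s := ∑ v, f v ^ 2
  have hs : 0 ≤ s := Finset.sum_nonneg fun v _ => sq_nonneg _
  have hsq : (2 * (h * s)) ^ 2 ≤ 2 * dirichletForm A f * (4 * (D * s)) :=
    calc (2 * (h * s)) ^ 2
        ≤ (∑ v, ∑ w, A v w * |f v ^ 2 - f w ^ 2|) ^ 2 := by gcongr; linarith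
      _ ≤ 2 * dirichletForm A f * ∑ v, ∑ w, A v w * (f v + f w) ^ 2 :=
        sq_sum_mul_abs_sq_sub_sq_le hA₀ f
      _ ≤ 2 * dirichletForm A f * (4 * (D * s)) := by
        gcongr
        exact (sum_mul_add_sq_le hA hA₀ f).trans (by gcongr)
  rcases hs.eq_or_lt with hs | hs
  · rw [← hs, mul_zero]
    positivity
  · exact le_of_mul_le_mul_right (by linarith) hs

/-- Cheeger's inequality. -/
theorem hasSpectralGap (hexp : IsExpanding A h) (hA : A.IsSymm) (hA₀ : ∀ v w, 0 ≤ A v w)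
    (hh : 0 ≤ h) {D : ℝ} (hD₀ : 0 < D) (hD : ∀ v, weightedDegree A v ≤ D) :
    HasSpectralGap A (h ^ 2 / (2 * D ^ 2)) := by
  intro f hf
  rcases isEmpty_or_nonempty V with hV | hV
  · simp [dirichletForm]
  obtain ⟨x, habove, hbelow⟩ := exists_median f
  set m := f x
  have hpos := hexp.sq_mul_sum_sq_le hA hA₀ hh hD₀.le hD (f := fun v => (f v - m)⁺)
    (fun v => posPart_nonneg _) (by simpa using habove)
  have hneg := hexp.sq_mul_sum_sq_le hA hA₀ hh hD₀.le hD (f := fun v => (f v - m)⁻)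
    (fun v => negPart_nonneg _) (by simpa using hbelow)
  have hpoincare : h ^ 2 * ∑ v, (f v - m) ^ 2 ≤ 2 * D * dirichletForm A f := by
    simp only [sq_eq_posPart_sq_add_negPart_sq (f _ - m), Finset.sum_add_distrib, mul_add]
    have hsplit := dirichletForm_posPart_add_negPart_le hA₀ fun v => f v - m
    rw [dirichletForm_sub_const] at hsplit
    linarith [mul_le_mul_of_nonneg_left hsplit (by positivity : 0 ≤ 2 * D)]
  have hvariance : ∑ v, weightedDegree A v * f v ^ 2 ≤ D * ∑ v, (f v - m) ^ 2 :=
    calc ∑ v, weightedDegree A v * f v ^ 2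
        ≤ ∑ v, weightedDegree A v * (f v - m) ^ 2 := by
          rw [sum_weightedDegree_mul_sub_sq, hf]
          have hvol : 0 ≤ totalWeight A := Finset.sum_nonneg fun v _ => weightedDegree_nonneg hA₀ v
          linarith [mul_nonneg (sq_nonneg m) hvol]
      _ ≤ D * ∑ v, (f v - m) ^ 2 := by
          rw [Finset.mul_sum]
          gcongr with v
          exact hD v
  rw [div_mul_eq_mul_div, div_le_iff₀ (by positivity)]
  calc h ^ 2 * ∑ v, weightedDegree A v * f v ^ 2
      ≤ h ^ 2 * (D * ∑ v, (f v - m) ^ 2) := by gcongr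
    _ = D * (h ^ 2 * ∑ v, (f v - m) ^ 2) := by ring
    _ ≤ D * (2 * D * dirichletForm A f) := by gcongr
    _ = dirichletForm A f * (2 * D ^ 2) := by ring

end IsExpanding

end Cheeger
section TraceInverse

open Matrix

variable {V : Type*} [DecidableEq V] {C : Matrix V V ℝ} {g : ℝ}

lemma posDef_one_sub (hg : 0 < g) (hgap : (1 - C - g • (1 : Matrix V V ℝ)).PosSemidef) :
    (1 - C).PosDef := by
  simpa using PosDef.posSemidef_add hgap (PosDef.one.smul hg)

variable [Fintype V]

/-- Multiplying by `1 - C` on both sides, this says that `(1 - C) ^ 2 - g • (1 - C)` is positive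
semidefinite. -/
lemma posSemidef_inv_smul_one_sub_inv (hg : 0 < g)
    (hgap : (1 - C - g • (1 : Matrix V V ℝ)).PosSemidef) :
    (g⁻¹ • (1 : Matrix V V ℝ) - (1 - C)⁻¹).PosSemidef := by
  set S := 1 - C
  set P := S - g • (1 : Matrix V V ℝ)
  have hS : S.PosDef := posDef_one_sub hg hgap
  have hinv : S⁻¹ * S = 1 := nonsing_inv_mul _ ((isUnit_iff_isUnit_det _).1 hS.isUnit)
  have hinv' : S * S⁻¹ = 1 := mul_eq_one_comm.1 hinv
  have hprod : (S⁻¹)ᴴ * (P ^ 2 + g • P) * S⁻¹ = 1 - g • S⁻¹ := by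
    have hfactor : P ^ 2 + g • P = S * (S - g • 1) := by
      simp only [P, pow_two, sub_mul, mul_sub, smul_sub, Matrix.smul_mul, Matrix.mul_smul, mul_one,
        one_mul, smul_smul]
      abel
    rw [hfactor, hS.inv.isHermitian.eq, ← mul_assoc, hinv, one_mul, sub_mul, hinv',
      Matrix.smul_mul, one_mul]
  have hpos := (((hgap.pow 2).add (hgap.smul hg.le)).conjTranspose_mul_mul_same S⁻¹).smul
    (inv_nonneg.2 hg.le)
  rwa [hprod, smul_sub, smul_smul, inv_mul_cancel₀ hg.ne', one_smul] at hpos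

lemma inv_one_sub_eq (hS : IsUnit (1 - C)) : (1 - C)⁻¹ = 1 + C + C * (1 - C)⁻¹ * C := by
  have hdet := (isUnit_iff_isUnit_det _).1 hS
  have hleft : C * (1 - C)⁻¹ = (1 - C)⁻¹ - 1 := by
    have h := mul_nonsing_inv _ hdet
    rw [sub_mul, one_mul] at h
    exact (sub_eq_of_eq_add' (sub_eq_iff_eq_add.1 h)).symm
  have hright : (1 - C)⁻¹ * C = (1 - C)⁻¹ - 1 := by
    have h := nonsing_inv_mul _ hdet
    rw [mul_sub, mul_one] at h
    exact (sub_eq_of_eq_add' (sub_eq_iff_eq_add.1 h)).symm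
  rw [hleft, sub_mul, hright, one_mul]
  abel

lemma card_add_trace_le_trace_inv (hC : C.IsHermitian) (hg : 0 < g)
    (hgap : (1 - C - g • (1 : Matrix V V ℝ)).PosSemidef) :
    Fintype.card V + C.trace ≤ (1 - C)⁻¹.trace := by
  have hS := posDef_one_sub hg hgap
  have hpos := (hS.inv.posSemidef.conjTranspose_mul_mul_same C).trace_nonneg
  rw [inv_one_sub_eq hS.isUnit, trace_add, trace_add, trace_one]
  rw [hC.eq] at hpos
  linarith

lemma trace_inv_le (hC : C.IsHermitian) (hg : 0 < g)
    (hgap : (1 - C - g • (1 : Matrix V V ℝ)).PosSemidef) :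
    (1 - C)⁻¹.trace ≤ Fintype.card V + C.trace + (C * C).trace / g := by
  have hpos := ((posSemidef_inv_smul_one_sub_inv hg hgap).conjTranspose_mul_mul_same C).trace_nonneg
  rw [inv_one_sub_eq (posDef_one_sub hg hgap).isUnit, trace_add, trace_add, trace_one]
  rw [hC.eq, mul_sub, sub_mul, trace_sub, Matrix.mul_smul, mul_one, Matrix.smul_mul, trace_smul,
    smul_eq_mul] at hpos
  rw [div_eq_inv_mul]
  linarith

end TraceInverse

section Kemeny

variable {V : Type*} [Fintype V] {A : Matrix V V ℝ}

open Matrix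

/-- The eigenvector `√d` of the symmetrized transition matrix `D^(-1/2) A D^(-1/2)`, with
eigenvalue `1`. -/
noncomputable def sqrtDegree (A : Matrix V V ℝ) (v : V) : ℝ := √(weightedDegree A v)

/-- The symmetrized transition matrix `D^(-1/2) A D^(-1/2)` with its eigenvalue `1` moved to `0`. -/
noncomputable def deflatedTransition (A : Matrix V V ℝ) : Matrix V V ℝ :=
  of fun v w => A v w / (sqrtDegree A v * sqrtDegree A w)
    - sqrtDegree A v * sqrtDegree A w / totalWeight A

lemma sqrtDegree_pos (hd : ∀ v, 0 < weightedDegree A v) (v : V) : 0 < sqrtDegree A v :=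
  Real.sqrt_pos.2 (hd v)

lemma sqrtDegree_sq (hd : ∀ v, 0 < weightedDegree A v) (v : V) :
    sqrtDegree A v ^ 2 = weightedDegree A v :=
  Real.sq_sqrt (hd v).le

lemma deflatedTransition_isHermitian (hA : A.IsSymm) : (deflatedTransition A).IsHermitian := by
  ext v w
  simp only [deflatedTransition, conjTranspose_apply, of_apply, hA.apply, star_trivial,
    mul_comm (sqrtDegree A w)]

lemma deflatedTransition_mulVec_sqrtDegree_mul (hd : ∀ v, 0 < weightedDegree A v) (f : V → ℝ)
    (v : V) :
    (deflatedTransition A *ᵥ fun w => sqrtDegree A w * f w) v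
      = (∑ w, A v w * f w) / sqrtDegree A v
        - sqrtDegree A v * (∑ w, weightedDegree A w * f w) / totalWeight A := by
  simp only [mulVec, dotProduct, deflatedTransition, of_apply, Finset.sum_div, Finset.mul_sum,
    ← Finset.sum_sub_distrib]
  refine Finset.sum_congr rfl fun w _ => ?_
  have hv := (sqrtDegree_pos hd v).ne'
  have hw := (sqrtDegree_pos hd w).ne'
  rw [← sqrtDegree_sq hd w]
  field_simp

lemma deflatedTransition_mulVec_sqrtDegree [Nonempty V] (hd : ∀ v, 0 < weightedDegree A v) :
    deflatedTransition A *ᵥ sqrtDegree A = 0 := by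
  funext v
  have h := deflatedTransition_mulVec_sqrtDegree_mul hd 1 v
  have hv := (sqrtDegree_pos hd v).ne'
  simp only [Pi.one_apply, mul_one] at h
  rw [h, ← totalWeight, ← weightedDegree, mul_div_cancel_right₀ _ (totalWeight_pos hd).ne',
    ← sqrtDegree_sq hd v, pow_two, mul_div_cancel_right₀ _ hv, sub_self, Pi.zero_apply]

lemma trace_deflatedTransition [Nonempty V] (hd : ∀ v, 0 < weightedDegree A v) :
    (deflatedTransition A).trace = ∑ v, A v v / weightedDegree A v - 1 := by
  simp only [trace, diag_apply, deflatedTransition, of_apply, Finset.sum_sub_distrib, ← pow_two,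
    sqrtDegree_sq hd, ← Finset.sum_div]
  rw [← totalWeight, div_self (totalWeight_pos hd).ne']

lemma trace_deflatedTransition_mul_self [Nonempty V] (hA : A.IsSymm)
    (hd : ∀ v, 0 < weightedDegree A v) :
    (deflatedTransition A * deflatedTransition A).trace
      = ∑ v, ∑ w, A v w ^ 2 / (weightedDegree A v * weightedDegree A w) - 1 := by
  have hvol := (totalWeight_pos hd).ne'
  have hentry (v w : V) : deflatedTransition A v w * deflatedTransition A w v
      = A v w ^ 2 / (weightedDegree A v * weightedDegree A w) - 2 / totalWeight A * A v w
        + weightedDegree A v * weightedDegree A w / totalWeight A ^ 2 := by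
    have hv := (sqrtDegree_pos hd v).ne'
    have hw := (sqrtDegree_pos hd w).ne'
    simp only [deflatedTransition, of_apply, hA.apply v w, ← sqrtDegree_sq hd]
    field_simp
    ring
  have hsum : ∑ v, ∑ w, A v w = totalWeight A := rfl
  have hsum' : ∑ v, weightedDegree A v = totalWeight A := rfl
  simp only [trace, diag_apply, mul_apply, hentry, Finset.sum_sub_distrib, Finset.sum_add_distrib,
    ← Finset.mul_sum, ← Finset.sum_div, ← Finset.sum_mul, hsum, hsum']
  field_simp
  ring

lemma sum_sq_sub_sum_mul_eq_dirichletForm (hA : A.IsSymm) (f : V → ℝ) :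
    ∑ v, weightedDegree A v * f v ^ 2 - ∑ v, f v * ∑ w, A v w * f w = dirichletForm A f := by
  have hexpand : ∑ v, ∑ w, A v w * (f v - f w) ^ 2
      = ∑ v, ∑ w, A v w * f v ^ 2 + ∑ v, ∑ w, A v w * f w ^ 2
        - 2 * ∑ v, f v * ∑ w, A v w * f w := by
    simp only [Finset.mul_sum, ← Finset.sum_add_distrib, ← Finset.sum_sub_distrib]
    exact Finset.sum_congr rfl fun v _ => Finset.sum_congr rfl fun w _ => by ring
  rw [dirichletForm, hexpand, sum_mul_apply_fst fun v => f v ^ 2,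
    sum_mul_apply_snd hA fun v => f v ^ 2]
  ring

lemma sum_sqrtDegree_mul_deflatedTransition_mulVec (hA : A.IsSymm)
    (hd : ∀ v, 0 < weightedDegree A v) (f : V → ℝ) :
    ∑ v, sqrtDegree A v * f v * (deflatedTransition A *ᵥ fun w => sqrtDegree A w * f w) v
      = ∑ v, weightedDegree A v * f v ^ 2 - dirichletForm A f
        - (∑ v, weightedDegree A v * f v) ^ 2 / totalWeight A := by
  rw [← sum_sq_sub_sum_mul_eq_dirichletForm hA, sub_sub_cancel, pow_two, mul_div_assoc,
    Finset.sum_mul, ← Finset.sum_sub_distrib]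
  refine Finset.sum_congr rfl fun v _ => ?_
  have hv := (sqrtDegree_pos hd v).ne'
  rw [deflatedTransition_mulVec_sqrtDegree_mul hd, ← sqrtDegree_sq hd v]
  field_simp

/-- Centring `f` changes both sides by multiples of the last term, with `g ≤ 1` on the left. -/
lemma HasSpectralGap.mul_sum_sq_le [Nonempty V] {g : ℝ} (hgap : HasSpectralGap A g) (hg : g ≤ 1)
    (hd : ∀ v, 0 < weightedDegree A v) (f : V → ℝ) :
    g * ∑ v, weightedDegree A v * f v ^ 2
      ≤ dirichletForm A f + (∑ v, weightedDegree A v * f v) ^ 2 / totalWeight A := by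
  have hvol := totalWeight_pos hd
  set s := ∑ v, weightedDegree A v * f v
  have hcentred : ∑ v, weightedDegree A v * (f v - s / totalWeight A) = 0 := by
    simp only [mul_sub, Finset.sum_sub_distrib, ← Finset.sum_mul]
    rw [← totalWeight, mul_div_cancel₀ _ hvol.ne', sub_self]
  have hpoincare := hgap _ hcentred
  rw [dirichletForm_sub_const, sum_weightedDegree_mul_sub_sq] at hpoincare
  have hmean : 2 * (s / totalWeight A) * s - (s / totalWeight A) ^ 2 * totalWeight A
      = s ^ 2 / totalWeight A := by
    field_simp
    ring
  have hsq : 0 ≤ s ^ 2 / totalWeight A := by positivity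
  nlinarith

lemma HasSpectralGap.posSemidef [Nonempty V] [DecidableEq V] {g : ℝ} (hgap : HasSpectralGap A g)
    (hg : g ≤ 1) (hA : A.IsSymm) (hd : ∀ v, 0 < weightedDegree A v) :
    (1 - deflatedTransition A - g • (1 : Matrix V V ℝ)).PosSemidef := by
  refine .of_dotProduct_mulVec_nonneg ?_ fun x => ?_
  · exact (isHermitian_one.sub (deflatedTransition_isHermitian hA)).sub
      (isHermitian_one.smul (.all g))
  obtain ⟨f, rfl⟩ : ∃ f : V → ℝ, x = fun v => sqrtDegree A v * f v :=
    ⟨fun v => x v / sqrtDegree A v, funext fun v =>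
      (mul_div_cancel₀ _ (sqrtDegree_pos hd v).ne').symm⟩
  have hform := sum_sqrtDegree_mul_deflatedTransition_mulVec hA hd f
  have hnorm : ∑ v, sqrtDegree A v * f v * (sqrtDegree A v * f v)
      = ∑ v, weightedDegree A v * f v ^ 2 :=
    Finset.sum_congr rfl fun v _ => by rw [← sqrtDegree_sq hd v]; ring
  have hpoincare := hgap.mul_sum_sq_le hg hd f
  simp only [star_trivial, sub_mulVec, one_mulVec, smul_mulVec, dotProduct_sub, dotProduct_smul]
  simp only [dotProduct, smul_eq_mul, hform, hnorm]
  linarith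

/-- The linear equations of first-step analysis for the mean hitting times `f v` of `w` from `v` by
the walk with edge weights `A`. -/
def SolvesHittingEquations (A : Matrix V V ℝ) (w : V) (f : V → ℝ) : Prop :=
  f w = 0 ∧ ∀ v, v ≠ w → f v = 1 + (∑ u, A v u * f u) / weightedDegree A v

/-- The average of `f` with respect to the invariant distribution of the walk with edge weights
`A`. -/
noncomputable def stationaryMean (A : Matrix V V ℝ) (f : V → ℝ) : ℝ :=
  ∑ w, weightedDegree A w / totalWeight A * f w

lemma sum_div_weightedDegree_le {h : ℝ} (hA₁ : ∀ v w, A v w ≤ 1) (hh : 0 < h)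
    (hd : ∀ v, h ≤ weightedDegree A v) :
    ∑ v, A v v / weightedDegree A v ≤ Fintype.card V / h := by
  rw [div_eq_mul_one_div, ← nsmul_eq_mul]
  exact Finset.sum_le_card_nsmul _ _ _ fun v _ => div_le_div₀ zero_le_one (hA₁ v v) hh (hd v)

lemma sum_sq_div_weightedDegree_le {h : ℝ} (hA₀ : ∀ v w, 0 ≤ A v w) (hA₁ : ∀ v w, A v w ≤ 1)
    (hh : 0 < h) (hd : ∀ v, h ≤ weightedDegree A v) :
    ∑ v, ∑ w, A v w ^ 2 / (weightedDegree A v * weightedDegree A w) ≤ Fintype.card V / h := by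
  rw [div_eq_mul_one_div, ← nsmul_eq_mul]
  refine Finset.sum_le_card_nsmul _ _ _ fun v _ => ?_
  have hv := hh.trans_le (hd v)
  calc ∑ w, A v w ^ 2 / (weightedDegree A v * weightedDegree A w)
      ≤ ∑ w, A v w / (weightedDegree A v * h) := by
        refine Finset.sum_le_sum fun w _ => div_le_div₀ (hA₀ v w) ?_ (mul_pos hv hh) ?_
        · exact pow_le_of_le_one (hA₀ v w) (hA₁ v w) two_ne_zero
        · exact mul_le_mul_of_nonneg_left (hd w) hv.le
    _ = 1 / h := by
        rw [← Finset.sum_div, ← weightedDegree, div_mul_eq_div_div, div_self hv.ne']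

variable [DecidableEq V]

/-- The mean hitting time of `w` from `v` in terms of the fundamental matrix
`(1 - deflatedTransition A)⁻¹`. -/
noncomputable def meanHittingTime (A : Matrix V V ℝ) (v w : V) : ℝ :=
  totalWeight A * ((1 - deflatedTransition A)⁻¹ w w / weightedDegree A w
    - (1 - deflatedTransition A)⁻¹ v w / (sqrtDegree A v * sqrtDegree A w))

lemma sqrtDegree_vecMul_inv_one_sub [Nonempty V] (hA : A.IsSymm)
    (hd : ∀ v, 0 < weightedDegree A v) (hS : IsUnit (1 - deflatedTransition A)) :
    sqrtDegree A ᵥ* (1 - deflatedTransition A)⁻¹ = sqrtDegree A := by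
  have hfix : sqrtDegree A ᵥ* (1 - deflatedTransition A) = sqrtDegree A := by
    rw [vecMul_sub, vecMul_one, ← (deflatedTransition_isHermitian hA).eq,
      conjTranspose_eq_transpose_of_trivial, vecMul_transpose,
      deflatedTransition_mulVec_sqrtDegree hd, sub_zero]
  nth_rw 1 [← hfix]
  rw [vecMul_vecMul, mul_nonsing_inv _ ((isUnit_iff_isUnit_det _).1 hS), vecMul_one]

lemma inv_one_sub_mulVec_sqrtDegree [Nonempty V] (hd : ∀ v, 0 < weightedDegree A v)
    (hS : IsUnit (1 - deflatedTransition A)) :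
    (1 - deflatedTransition A)⁻¹ *ᵥ sqrtDegree A = sqrtDegree A := by
  have hfix : (1 - deflatedTransition A) *ᵥ sqrtDegree A = sqrtDegree A := by
    rw [sub_mulVec, one_mulVec, deflatedTransition_mulVec_sqrtDegree hd, sub_zero]
  nth_rw 1 [← hfix]
  rw [mulVec_mulVec, nonsing_inv_mul _ ((isUnit_iff_isUnit_det _).1 hS), one_mulVec]

lemma stationaryMean_meanHittingTime [Nonempty V] (hd : ∀ v, 0 < weightedDegree A v)
    (hS : IsUnit (1 - deflatedTransition A)) (v : V) :
    stationaryMean A (meanHittingTime A v) = (1 - deflatedTransition A)⁻¹.trace - 1 := by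
  have hrow := congrFun (inv_one_sub_mulVec_sqrtDegree hd hS) v
  have hvol := (totalWeight_pos hd).ne'
  have hv := (sqrtDegree_pos hd v).ne'
  rw [← div_self hv]
  nth_rw 1 [← hrow]
  rw [mulVec, dotProduct, Finset.sum_div, trace, ← Finset.sum_sub_distrib]
  unfold stationaryMean
  refine Finset.sum_congr rfl fun w _ => ?_
  have hw := (sqrtDegree_pos hd w).ne'
  rw [diag_apply, meanHittingTime, ← sqrtDegree_sq hd w]
  field_simp

/-- An off-diagonal entry of the identity `(1 - C) * (1 - C)⁻¹ = 1`. -/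
lemma inv_one_sub_apply_of_ne [Nonempty V] (hA : A.IsSymm) (hd : ∀ v, 0 < weightedDegree A v)
    (hS : IsUnit (1 - deflatedTransition A)) {v w : V} (hvw : v ≠ w) :
    (1 - deflatedTransition A)⁻¹ v w
      = (∑ u, A v u * ((1 - deflatedTransition A)⁻¹ u w / sqrtDegree A u)) / sqrtDegree A v
        - sqrtDegree A v * sqrtDegree A w / totalWeight A := by
  set G := (1 - deflatedTransition A)⁻¹ with hG
  have hcol : ∑ u, sqrtDegree A u * G u w = sqrtDegree A w :=
    congrFun (sqrtDegree_vecMul_inv_one_sub hA hd hS) w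
  have hweight (u : V) :
      weightedDegree A u * (G u w / sqrtDegree A u) = sqrtDegree A u * G u w := by
    have hu := (sqrtDegree_pos hd u).ne'
    rw [← sqrtDegree_sq hd]
    field_simp
  have hinv := congrFun (congrFun (mul_nonsing_inv _ ((isUnit_iff_isUnit_det _).1 hS)) v) w
  rw [sub_mul, one_mul, Matrix.sub_apply, one_apply_ne hvw, ← hG, sub_eq_zero] at hinv
  have hmulVec := deflatedTransition_mulVec_sqrtDegree_mul hd (fun u => G u w / sqrtDegree A u) v
  simp only [mul_div_cancel₀ _ (sqrtDegree_pos hd _).ne', hweight, hcol] at hmulVec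
  exact hinv.trans hmulVec

lemma solvesHittingEquations_meanHittingTime [Nonempty V] (hA : A.IsSymm)
    (hd : ∀ v, 0 < weightedDegree A v) (hS : IsUnit (1 - deflatedTransition A)) (w : V) :
    SolvesHittingEquations A w fun v => meanHittingTime A v w := by
  have hw := (sqrtDegree_pos hd w).ne'
  refine ⟨by simp only [meanHittingTime, ← pow_two, sqrtDegree_sq hd, sub_self, mul_zero],
    fun v hvw => ?_⟩
  have hv := (sqrtDegree_pos hd v).ne'
  have hvol := (totalWeight_pos hd).ne'
  have hsum : ∑ u, A v u * meanHittingTime A u w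
      = totalWeight A * (weightedDegree A v *
          ((1 - deflatedTransition A)⁻¹ w w / weightedDegree A w)
        - (∑ u, A v u * ((1 - deflatedTransition A)⁻¹ u w / sqrtDegree A u)) / sqrtDegree A w) := by
    simp only [meanHittingTime, weightedDegree, Finset.sum_mul, Finset.sum_div,
      ← Finset.sum_sub_distrib, Finset.mul_sum]
    refine Finset.sum_congr rfl fun u _ => ?_
    have hu := (sqrtDegree_pos hd u).ne'
    field_simp
  beta_reduce
  rw [hsum]
  simp only [meanHittingTime, inv_one_sub_apply_of_ne hA hd hS hvw, ← sqrtDegree_sq hd]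
  field_simp
  ring

/-- The average is the Kemeny constant `∑ 1 / (1 - λ)` over the eigenvalues `λ ≠ 1` of the walk. -/
theorem stationaryMean_meanHittingTime_mem_Icc [Nonempty V] {g h : ℝ} (hgap : HasSpectralGap A g)
    (hg₀ : 0 < g) (hg₁ : g ≤ 1) (hA : A.IsSymm) (hA₀ : ∀ v w, 0 ≤ A v w) (hA₁ : ∀ v w, A v w ≤ 1)
    (hh : 0 < h) (hd : ∀ v, h ≤ weightedDegree A v) (v : V) :
    stationaryMean A (meanHittingTime A v) ∈
      Set.Icc (Fintype.card V - 2 : ℝ) (Fintype.card V * (1 + 1 / h + 1 / (h * g))) := by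
  have hd₀ (v : V) : 0 < weightedDegree A v := hh.trans_le (hd v)
  have hpsd := hgap.posSemidef hg₁ hA hd₀
  have hC := deflatedTransition_isHermitian hA
  have hlower := card_add_trace_le_trace_inv hC hg₀ hpsd
  have hupper := trace_inv_le hC hg₀ hpsd
  rw [trace_deflatedTransition hd₀] at hlower hupper
  rw [trace_deflatedTransition_mul_self hA hd₀] at hupper
  rw [stationaryMean_meanHittingTime hd₀ (posDef_one_sub hg₀ hpsd).isUnit, Set.mem_Icc]
  constructor
  · have hdiag : 0 ≤ ∑ v, A v v / weightedDegree A v :=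
      Finset.sum_nonneg fun v _ => div_nonneg (hA₀ v v) (hd₀ v).le
    linarith
  · have hdiag := sum_div_weightedDegree_le hA₁ hh hd
    have hsq : (∑ v, ∑ w, A v w ^ 2 / (weightedDegree A v * weightedDegree A w) - 1) / g
        ≤ Fintype.card V / h / g :=
      div_le_div_of_nonneg_right
        ((sub_le_self _ zero_le_one).trans (sum_sq_div_weightedDegree_le hA₀ hA₁ hh hd)) hg₀.le
    rw [mul_add, mul_add, mul_one, mul_one_div, mul_one_div, ← div_div]
    linarith

end Kemeny

section HittingTime

variable {V : Type*}

/-- The adjacency matrix of the graph with edge indicators `ε`; a loop gives a diagonal entry. -/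
def adjacency (ε : Sym2 V → Bool) : Matrix V V ℝ :=
  Matrix.of fun v w => if ε s(v, w) = true then 1 else 0

lemma adjacency_isSymm (ε : Sym2 V → Bool) : (adjacency ε).IsSymm := by
  ext v w
  simp [adjacency, Sym2.eq_swap]

lemma adjacency_nonneg (ε : Sym2 V → Bool) (v w : V) : 0 ≤ adjacency ε v w := by
  simp only [adjacency, Matrix.of_apply]
  positivity

lemma adjacency_le_one (ε : Sym2 V → Bool) (v w : V) : adjacency ε v w ≤ 1 :=
  ite_le_one le_rfl zero_le_one

lemma firstHit_eq_tsum (w : V) (x : ℕ → V) :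
    firstHit w x = ∑' t, {y : ℕ → V | ∀ s ≤ t, y s ≠ w}.indicator 1 x := by
  classical
  simp only [Set.indicator_apply, Set.mem_ofPred_eq, Pi.one_apply]
  by_cases hx : ∃ t, x t = w
  · have hfirst : firstHit w x = Nat.find hx :=
      le_antisymm (iInf₂_le (f := fun t (_ : x t = w) => (t : ℝ≥0∞)) _ (Nat.find_spec hx))
        (le_iInf₂ fun t ht => by exact_mod_cast Nat.find_min' hx ht)
    simp only [hfirst, ← Nat.lt_find_iff hx]
    rw [tsum_eq_sum (s := Finset.range (Nat.find hx))
      fun t ht => if_neg (mt Finset.mem_range.2 ht),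
      Finset.sum_congr rfl fun t ht => if_pos (Finset.mem_range.1 ht)]
    simp
  · push Not at hx
    simp [firstHit, hx]

variable [Fintype V]

lemma weightedDegree_adjacency (ε : Sym2 V → Bool) (v : V) :
    weightedDegree (adjacency ε) v = degree ε v := by
  simp [weightedDegree, adjacency, degree, neighbors]

/-- Minimum principle: a minimum of `f` away from `w` would violate the equation there. -/
lemma SolvesHittingEquations.nonneg {A : Matrix V V ℝ} {w : V} {f : V → ℝ}
    (hf : SolvesHittingEquations A w f) (hA₀ : ∀ v w, 0 ≤ A v w)
    (hd : ∀ v, 0 < weightedDegree A v) (v : V) : 0 ≤ f v := by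
  obtain ⟨x, -, hmin⟩ := Finset.univ.exists_min_image f ⟨w, Finset.mem_univ w⟩
  suffices hxw : x = w from hf.1 ▸ hxw ▸ hmin v (Finset.mem_univ v)
  by_contra hxw
  have hmean : f x ≤ (∑ u, A x u * f u) / weightedDegree A x := by
    rw [le_div_iff₀ (hd x), mul_comm, weightedDegree, Finset.sum_mul]
    gcongr with u hu
    · exact hA₀ x u
    · exact hmin u hu
  linarith [hf.2 x hxw]

lemma sum_step_mul_ofReal (ε : Sym2 V → Bool) {v : V} (hv : 0 < degree ε v) {f : V → ℝ}
    (hf : ∀ u, 0 ≤ f u) :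
    ∑ u, step ε v u * ENNReal.ofReal (f u)
      = ENNReal.ofReal ((∑ u, adjacency ε v u * f u) / weightedDegree (adjacency ε) v) := by
  rw [weightedDegree_adjacency, Finset.sum_div, ENNReal.ofReal_sum_of_nonneg fun u _ =>
    div_nonneg (mul_nonneg (adjacency_nonneg ε v u) (hf u)) (Nat.cast_nonneg _)]
  refine Finset.sum_congr rfl fun u _ => ?_
  have hstep : step ε v u = ENNReal.ofReal (adjacency ε v u / degree ε v) := by
    rw [ENNReal.ofReal_div_of_pos (by exact_mod_cast hv), ENNReal.ofReal_natCast, step,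
      dif_pos (Finset.card_pos.1 hv), PMF.uniformOfFinset_apply]
    by_cases hu : ε s(v, u) = true <;> simp [neighbors, degree, adjacency, hu]
  rw [hstep, ← ENNReal.ofReal_mul (div_nonneg (adjacency_nonneg ε v u) (Nat.cast_nonneg _)),
    div_mul_eq_mul_div]

section Trajectory

variable [MeasurableSpace V] [MeasurableSingletonClass V]

lemma lintegral_stepKernel (ε : Sym2 V → Bool) (v : V) (g : V → ℝ≥0∞) :
    ∫⁻ u, g u ∂(stepKernel ε v) = ∑ u, step ε v u * g u := by
  rw [lintegral_fintype]
  refine Finset.sum_congr rfl fun u _ => ?_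
  rw [mul_comm]
  exact congrArg (· * g u) (PMF.toMeasure_apply_singleton _ _ (measurableSet_singleton u))

lemma lintegral_walkLaw_zero (ε : Sym2 V → Bool) (v : V) (g : V → ℝ≥0∞) :
    ∫⁻ x, g (x 0) ∂walkLaw ε v = g v := by
  have hm : Measurable fun y : (i : Finset.Iic 0) → V => g (y ⟨0, Finset.mem_Iic.2 le_rfl⟩) :=
    (measurable_of_countable g).comp (measurable_pi_apply _)
  calc ∫⁻ x, g (x 0) ∂walkLaw ε v
      = ∫⁻ y, g (y ⟨0, Finset.mem_Iic.2 le_rfl⟩)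
          ∂(walkLaw ε v).map (Preorder.frestrictLe (π := fun _ => V) 0) := by
        rw [lintegral_map hm (by fun_prop)]
        rfl
    _ = g v := by
        rw [walkLaw, Kernel.trajMeasure, Measure.map_dirac, Measure.dirac_bind (by fun_prop),
          Kernel.traj_map_frestrictLe_apply, Kernel.partialTraj_self, Kernel.id_apply,
          lintegral_dirac' _ hm]
        rfl

/-- The Markov property at time `t`. -/
lemma lintegral_walkLaw_succ (ε : Sym2 V → Bool) (v : V) (t : ℕ)
    (F : ((i : Finset.Iic t) → V) → V → ℝ≥0∞) :
    ∫⁻ x, F (Preorder.frestrictLe (π := fun _ => V) t x) (x (t + 1)) ∂walkLaw ε v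
      = ∫⁻ x, ∑ u, step ε (x t) u * F (Preorder.frestrictLe (π := fun _ => V) t x) u
          ∂walkLaw ε v := by
  have hF : Measurable (Function.uncurry F) := measurable_of_countable _
  change ∫⁻ x, Function.uncurry F
    (Preorder.frestrictLe (π := fun _ => V) t x, x (t + 1)) ∂walkLaw ε v = _
  rw [← lintegral_map (f := Function.uncurry F)
    (g := fun x : ℕ → V => (Preorder.frestrictLe (π := fun _ => V) t x, x (t + 1)))
    hF (by fun_prop), walkLaw, ← Kernel.map_frestrictLe_trajMeasure_compProd_eq_map_trajMeasure,
    Measure.lintegral_compProd hF, lintegral_map (measurable_of_countable _) (by fun_prop)]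
  refine lintegral_congr fun x => ?_
  rw [historyKernel, Kernel.comap_apply, lintegral_stepKernel]
  rfl

end Trajectory

section KilledWalk

variable [DecidableEq V]

/-- The remainder `Q ^ t *ᵥ k` after `t` steps is dominated by `C • Q ^ t *ᵥ e`, the general term of
a convergent series. -/
lemma tsum_pow_mulVec_apply {Q : Matrix V V ℝ≥0∞} {e k : V → ℝ≥0∞} (hk : k = e + Q.mulVec k)
    {C : ℝ≥0∞} (hC : C ≠ ⊤) (hle : k ≤ C • e) {v : V} (hv : k v ≠ ⊤) :
    ∑' t, (Q ^ t).mulVec e v = k v := by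
  have hpartial (T : ℕ) :
      ∑ t ∈ Finset.range T, (Q ^ t).mulVec e v + (Q ^ T).mulVec k v = k v := by
    induction T with
    | zero => simp
    | succ T ih =>
      have hpow : (Q ^ T).mulVec k v = (Q ^ T).mulVec e v + (Q ^ (T + 1)).mulVec k v := by
        conv_lhs => rw [hk]
        rw [Matrix.mulVec_add, Matrix.mulVec_mulVec, ← pow_succ, Pi.add_apply]
      rw [Finset.sum_range_succ, add_assoc, ← hpow, ih]
  have hsum : ∑' t, (Q ^ t).mulVec e v ≤ k v := by
    rw [ENNReal.tsum_eq_iSup_nat]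
    exact iSup_le fun T => (hpartial T) ▸ le_self_add
  have hterm : Tendsto (fun T => (Q ^ T).mulVec e v) atTop (𝓝 0) :=
    ENNReal.tendsto_atTop_zero_of_tsum_ne_top (ne_top_of_le_ne_top hv hsum)
  have hrest (T : ℕ) : (Q ^ T).mulVec k v ≤ C * (Q ^ T).mulVec e v := by
    rw [← smul_eq_mul, ← Pi.smul_apply, ← Matrix.mulVec_smul]
    exact Finset.sum_le_sum fun u _ => mul_le_mul_right (hle u) _
  have hrest_zero : Tendsto (fun T => (Q ^ T).mulVec k v) atTop (𝓝 0) :=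
    tendsto_of_tendsto_of_tendsto_of_le_of_le tendsto_const_nhds
      (by simpa using ENNReal.Tendsto.const_mul hterm (Or.inr hC)) (fun T => zero_le) hrest
  have hlim := (ENNReal.tendsto_nat_tsum fun t => (Q ^ t).mulVec e v).add hrest_zero
  simp only [hpartial, add_zero] at hlim
  exact tendsto_nhds_unique hlim tendsto_const_nhds

/-- The transition matrix of the walk that is killed when it is in `w`. -/
noncomputable def killedStep (ε : Sym2 V → Bool) (w : V) : Matrix V V ℝ≥0∞ :=
  Matrix.of fun v u => if v = w then 0 else step ε v u

lemma killedStep_mulVec_self (ε : Sym2 V → Bool) (w : V) (g : V → ℝ≥0∞) :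
    (killedStep ε w).mulVec g w = 0 := by
  simp [killedStep, Matrix.mulVec, dotProduct]

lemma killedStep_mulVec_of_ne (ε : Sym2 V → Bool) {v w : V} (hv : v ≠ w) (g : V → ℝ≥0∞) :
    (killedStep ε w).mulVec g v = ∑ u, step ε v u * g u := by
  simp [killedStep, Matrix.mulVec, dotProduct, hv]

lemma tsum_killedStep_pow_mulVec (ε : Sym2 V → Bool) (hd : ∀ v, 0 < degree ε v) {w : V} {f : V → ℝ}
    (hf : SolvesHittingEquations (adjacency ε) w f) (v : V) :
    ∑' t, (killedStep ε w ^ t).mulVec (({w}ᶜ : Set V).indicator 1) v = ENNReal.ofReal (f v) := by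
  have hd' (v : V) : 0 < weightedDegree (adjacency ε) v := by
    rw [weightedDegree_adjacency]
    exact_mod_cast hd v
  have hf₀ := hf.nonneg (adjacency_nonneg ε) hd'
  refine tsum_pow_mulVec_apply (k := fun v => ENNReal.ofReal (f v)) ?_
    (C := ∑ u, ENNReal.ofReal (f u)) (ENNReal.sum_ne_top.2 fun _ _ => ENNReal.ofReal_ne_top) ?_
    ENNReal.ofReal_ne_top
  · funext u
    rw [Pi.add_apply]
    by_cases hu : u = w
    · subst hu
      simp [hf.1, killedStep_mulVec_self]
    · rw [killedStep_mulVec_of_ne ε hu, sum_step_mul_ofReal ε (hd u) hf₀, hf.2 u hu,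
        ENNReal.ofReal_add zero_le_one (div_nonneg (Finset.sum_nonneg fun x _ =>
          mul_nonneg (adjacency_nonneg ε u x) (hf₀ x)) (hd' u).le)]
      simp [hu]
  · intro u
    by_cases hu : u = w
    · simp [hu, hf.1]
    · simpa [hu] using Finset.single_le_sum (f := fun x => ENNReal.ofReal (f x))
        (fun x _ => zero_le) (Finset.mem_univ u)

variable [MeasurableSpace V] [MeasurableSingletonClass V]

lemma lintegral_walkLaw_avoiding (ε : Sym2 V → Bool) (v w : V) (t : ℕ)
    {g : V → ℝ≥0∞} (hg : g w = 0) :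
    ∫⁻ x, {y : ℕ → V | ∀ s ≤ t, y s ≠ w}.indicator (fun y => g (y t)) x ∂walkLaw ε v
      = (killedStep ε w ^ t).mulVec g v := by
  induction t generalizing g with
  | zero =>
    rw [pow_zero, Matrix.one_mulVec, ← lintegral_walkLaw_zero ε v g]
    refine lintegral_congr fun x => ?_
    by_cases hx : x 0 = w <;> simp [hx, hg]
  | succ t ih =>
    rw [pow_succ, ← Matrix.mulVec_mulVec, ← ih (killedStep_mulVec_self ε w g)]
    have hmarkov := lintegral_walkLaw_succ ε v t
      fun y u => {y | ∀ s, y s ≠ w}.indicator (fun _ => g u) y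
    have hiff (x : ℕ → V) :
        (∀ s : Finset.Iic t, Preorder.frestrictLe (π := fun _ => V) t x s ≠ w) ↔
          ∀ s ≤ t, x s ≠ w := by
      simp
    simp only [Set.indicator_apply, Set.mem_ofPred_eq, hiff] at hmarkov ⊢
    convert hmarkov using 1 <;> refine lintegral_congr fun x => ?_
    · by_cases hx : x (t + 1) = w
      · simp [hx, hg]
      · simp [Nat.le_succ_iff_eq_or_le, or_imp, forall_and, hx]
    · by_cases hx : ∀ s ≤ t, x s ≠ w
      · simp only [if_pos hx, killedStep_mulVec_of_ne ε (hx t le_rfl)]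
      · simp [hx]

lemma hittingTime_eq_tsum (ε : Sym2 V → Bool) (v w : V) :
    hittingTime ε v w = ∑' t, (killedStep ε w ^ t).mulVec (({w}ᶜ : Set V).indicator 1) v := by
  have hm (t : ℕ) : MeasurableSet {x : ℕ → V | ∀ s ≤ t, x s ≠ w} :=
    (Measurable.forall fun s => .forall fun _ =>
      ((measurable_pi_apply s).eq_const w).not).setOf
  rw [hittingTime, lintegral_congr (firstHit_eq_tsum w),
    lintegral_tsum fun t => (measurable_one.indicator (hm t)).aemeasurable]
  refine tsum_congr fun t => ?_
  rw [← lintegral_walkLaw_avoiding ε v w t (by simp)]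
  congr 1 with x
  by_cases hx : ∀ s ≤ t, x s ≠ w <;> simp [Set.indicator_apply, hx]

end KilledWalk

variable [MeasurableSpace V] [MeasurableSingletonClass V]

lemma hittingTime_eq_ofReal (ε : Sym2 V → Bool) (hd : ∀ v, 0 < degree ε v) {w : V} {f : V → ℝ}
    (hf : SolvesHittingEquations (adjacency ε) w f) (v : V) :
    hittingTime ε v w = ENNReal.ofReal (f v) := by
  classical
  rw [hittingTime_eq_tsum, tsum_killedStep_pow_mulVec ε hd hf]

lemma avgHittingTime_eq_ofReal (ε : Sym2 V → Bool) (hd : ∀ v, 0 < degree ε v) {H : V → V → ℝ}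
    (hH : ∀ w, SolvesHittingEquations (adjacency ε) w fun v => H v w) (v : V) :
    avgHittingTime ε v = ENNReal.ofReal (stationaryMean (adjacency ε) (H v)) := by
  have : Nonempty V := ⟨v⟩
  have hd' (v : V) : 0 < weightedDegree (adjacency ε) v := by
    rw [weightedDegree_adjacency]
    exact_mod_cast hd v
  have hvol := totalWeight_pos hd'
  have hH₀ (w : V) : 0 ≤ H v w := (hH w).nonneg (adjacency_nonneg ε) hd' v
  rw [avgHittingTime, stationaryMean, ENNReal.ofReal_sum_of_nonneg fun w _ =>
    mul_nonneg (div_nonneg (hd' w).le hvol.le) (hH₀ w)]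
  refine Finset.sum_congr rfl fun w _ => ?_
  rw [hittingTime_eq_ofReal ε hd (hH w), ENNReal.ofReal_mul (div_nonneg (hd' w).le hvol.le),
    ENNReal.ofReal_div_of_pos hvol]
  simp only [totalWeight, weightedDegree_adjacency, stationary, ENNReal.ofReal_natCast,
    ENNReal.ofReal_sum_of_nonneg fun (x : V) _ => (Nat.cast_nonneg (degree ε x) : (0 : ℝ) ≤ _)]

end HittingTime

section Expanding

variable {V : Type*} [Fintype V] [DecidableEq V] {ε : Sym2 V → Bool} {h : ℝ}

lemma cutWeight_compl {A : Matrix V V ℝ} (hA : A.IsSymm) (S : Finset V) :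
    cutWeight A Sᶜ = cutWeight A S := by
  rw [cutWeight, compl_compl]
  exact Finset.sum_comm.trans
    (Finset.sum_congr rfl fun v _ => Finset.sum_congr rfl fun w _ => hA.apply v w)

/-- The component of `u` and its complement are not left by any edge, and one of the two contains
at most half of the vertices. -/
lemma IsExpanding.isConnected [Nonempty V] (hexp : IsExpanding (adjacency ε) h) (hh : 0 < h) :
    IsConnected ε := by
  set G := SimpleGraph.fromEdgeSet {e | ε e = true} with hG
  refine ⟨fun u v => ?_⟩
  by_contra huv
  classical
  set S : Finset V := {x | G.Reachable u x}
  have hcut : cutWeight (adjacency ε) S = 0 := by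
    refine Finset.sum_eq_zero fun x hx => Finset.sum_eq_zero fun y hy => if_neg fun hxy => ?_
    have hux : G.Reachable u x := by simpa [S] using hx
    have huy : ¬ G.Reachable u y := by simpa [S] using hy
    refine huy (hux.trans (SimpleGraph.Adj.reachable ?_))
    rw [hG, SimpleGraph.fromEdgeSet_adj]
    exact ⟨hxy, fun hxy => huy (hxy ▸ hux)⟩
  have hu : 0 < #S := Finset.card_pos.2 ⟨u, by simp [S]⟩
  have hv : 0 < #Sᶜ := Finset.card_pos.2 ⟨v, by simpa [S] using huv⟩
  rcases le_total (2 * #S) (Fintype.card V) with hle | hle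
  · exact (mul_pos hh (Nat.cast_pos.2 hu)).not_ge (hcut ▸ hexp S hle)
  · have hle' : 2 * #Sᶜ ≤ Fintype.card V := by
      have := Finset.card_add_card_compl S
      lia
    rw [← cutWeight_compl (adjacency_isSymm ε)] at hcut
    exact (mul_pos hh (Nat.cast_pos.2 hv)).not_ge (hcut ▸ hexp Sᶜ hle')

lemma IsExpanding.le_weightedDegree {A : Matrix V V ℝ} (hexp : IsExpanding A h)
    (hA₀ : ∀ v w, 0 ≤ A v w) (hV : 2 ≤ Fintype.card V) (v : V) : h ≤ weightedDegree A v := by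
  have hcut := hexp {v} (by simpa using hV)
  rw [cutWeight, Finset.sum_singleton, Finset.card_singleton, Nat.cast_one, mul_one] at hcut
  exact hcut.trans (Finset.sum_le_univ_sum_of_nonneg fun w => hA₀ v w)

lemma IsExpanding.avgHittingTime_mem_Icc [MeasurableSpace V] [MeasurableSingletonClass V]
    (hexp : IsExpanding (adjacency ε) h) (hh : 0 < h) (hV : 2 ≤ Fintype.card V) {D : ℝ}
    (hD : ∀ v, (degree ε v : ℝ) ≤ D) (v : V) :
    avgHittingTime ε v ∈ Set.Icc (ENNReal.ofReal (Fintype.card V - 2))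
      (ENNReal.ofReal (Fintype.card V * (1 + 1 / h + 2 * D ^ 2 / h ^ 3))) := by
  have : Nonempty V := ⟨v⟩
  have hdeg := hexp.le_weightedDegree (adjacency_nonneg ε) hV
  have hdeg₀ (v : V) : 0 < degree ε v := by
    exact_mod_cast weightedDegree_adjacency ε v ▸ hh.trans_le (hdeg v)
  have hhD : h ≤ D := (hdeg v).trans (weightedDegree_adjacency ε v ▸ hD v)
  have hD₀ : 0 < D := hh.trans_le hhD
  set g := h ^ 2 / (2 * D ^ 2) with hg
  have hg₀ : 0 < g := by positivity
  have hg₁ : g ≤ 1 := by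
    rw [hg, div_le_one (by positivity)]
    nlinarith
  have hgap : HasSpectralGap (adjacency ε) g :=
    hexp.hasSpectralGap (adjacency_isSymm ε) (adjacency_nonneg ε) hh.le hD₀
      fun v => weightedDegree_adjacency ε v ▸ hD v
  have hH := stationaryMean_meanHittingTime_mem_Icc hgap hg₀ hg₁ (adjacency_isSymm ε)
    (adjacency_nonneg ε) (adjacency_le_one ε) hh hdeg v
  have hunit : IsUnit (1 - deflatedTransition (adjacency ε)) :=
    (posDef_one_sub hg₀ (hgap.posSemidef hg₁ (adjacency_isSymm ε)
      fun v => hh.trans_le (hdeg v))).isUnit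
  have hconst : 1 / (h * g) = 2 * D ^ 2 / h ^ 3 := by
    rw [hg]
    field_simp
  rw [avgHittingTime_eq_ofReal ε hdeg₀ (solvesHittingEquations_meanHittingTime
    (adjacency_isSymm ε) (fun v => hh.trans_le (hdeg v)) hunit), ← hconst]
  exact ⟨ENNReal.ofReal_le_ofReal hH.1, ENNReal.ofReal_le_ofReal hH.2⟩

lemma IsExpanding.avgHittingTime_mem_Icc_mul [MeasurableSpace V] [MeasurableSingletonClass V]
    (hexp : IsExpanding (adjacency ε) h) (hh : 0 < h) (hV : 2 ≤ Fintype.card V) {D δ : ℝ}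
    (hD : ∀ v, (degree ε v : ℝ) ≤ D) (hVδ : 2 ≤ δ * Fintype.card V)
    (hδ : 1 / h + 2 * D ^ 2 / h ^ 3 ≤ δ) (v : V) :
    avgHittingTime ε v ∈ Set.Icc (ENNReal.ofReal ((1 - δ) * Fintype.card V))
      (ENNReal.ofReal ((1 + δ) * Fintype.card V)) := by
  refine Set.Icc_subset_Icc (ENNReal.ofReal_le_ofReal ?_) (ENNReal.ofReal_le_ofReal ?_)
    (hexp.avgHittingTime_mem_Icc hh hV hD v)
  · linarith
  · rw [mul_comm, add_assoc]
    gcongr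

end Expanding

section Chernoff

variable {E : Type*}

/-- The number of successes among the trials in `F`, as a real number. -/
def successCount (F : Finset E) (ε : E → Bool) : ℝ := ∑ e ∈ F, if ε e = true then 1 else 0

variable [Fintype E]

/-- The law of independent Bernoulli variables with parameters `P`. -/
noncomputable abbrev bernoulliProduct (P : E → unitInterval) : Measure (E → Bool) :=
  Measure.pi fun e => bernoulliMeasure true false (P e)

variable (P : E → unitInterval)

lemma mgf_successCount_le (F : Finset E) (t : ℝ) :
    mgf (successCount F) (bernoulliProduct P) t
      ≤ Real.exp ((Real.exp t - 1) * ∑ e ∈ F, (P e : ℝ)) := by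
  have hindep : iIndepFun (fun e (ε : E → Bool) => if ε e = true then (1 : ℝ) else 0)
      (bernoulliProduct P) :=
    iIndepFun_pi (X := fun _ b => if b = true then (1 : ℝ) else 0)
      fun _ => (measurable_of_finite _).aemeasurable
  have hsum : successCount F = ∑ e ∈ F, fun ε => if ε e = true then (1 : ℝ) else 0 := by
    ext ε
    simp [successCount]
  rw [hsum, hindep.mgf_sum fun e => measurable_of_finite _, Finset.mul_sum, Real.exp_sum]
  refine Finset.prod_le_prod (fun e _ => mgf_nonneg) fun e _ => ?_
  rw [mgf, integral_comp_eval (μ := fun e => bernoulliMeasure true false (P e))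
    (f := fun b : Bool => Real.exp (t * if b = true then (1 : ℝ) else 0))
    (measurable_of_finite _).aestronglyMeasurable, integral_bernoulliMeasure]
  have hexp := Real.add_one_le_exp ((Real.exp t - 1) * (P e : ℝ))
  simp only [if_true, mul_one, Bool.false_eq_true, if_false, mul_zero, Real.exp_zero, smul_eq_mul]
  linarith

lemma measureReal_successCount_le_half_le (F : Finset E) {m : ℝ} (hm : m ≤ ∑ e ∈ F, (P e : ℝ)) :
    (bernoulliProduct P).real {ε | successCount F ε ≤ m / 2} ≤ Real.exp (-m / 10) := by
  rcases le_or_gt m 0 with hm₀ | hm₀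
  · exact measureReal_le_one.trans (Real.one_le_exp (by linarith))
  have hexp : Real.exp (-1) ≤ 2 / 5 := by
    rw [Real.exp_neg, inv_le_comm₀ (Real.exp_pos _) (by norm_num)]
    linarith [Real.exp_one_gt_d9]
  calc (bernoulliProduct P).real {ε | successCount F ε ≤ m / 2}
      ≤ Real.exp (-(-1) * (m / 2)) * mgf (successCount F) (bernoulliProduct P) (-1) :=
        measure_le_le_exp_mul_mgf _ (by norm_num) .of_finite
    _ ≤ Real.exp (m / 2) * Real.exp ((Real.exp (-1) - 1) * ∑ e ∈ F, (P e : ℝ)) := by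
        rw [neg_neg, one_mul]
        gcongr
        exact mgf_successCount_le P F (-1)
    _ ≤ Real.exp (-m / 10) := by
        rw [← Real.exp_add, Real.exp_le_exp]
        nlinarith

lemma measureReal_three_mul_le_successCount_le (F : Finset E) {m : ℝ}
    (hm : ∑ e ∈ F, (P e : ℝ) ≤ m) :
    (bernoulliProduct P).real {ε | 3 * m ≤ successCount F ε} ≤ Real.exp (-m) := by
  have hm₀ : 0 ≤ m := (Finset.sum_nonneg fun e _ => (P e).2.1).trans hm
  have hexp := Real.exp_one_lt_d9
  calc (bernoulliProduct P).real {ε | 3 * m ≤ successCount F ε}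
      ≤ Real.exp (-1 * (3 * m)) * mgf (successCount F) (bernoulliProduct P) 1 :=
        measure_ge_le_exp_mul_mgf _ zero_le_one .of_finite
    _ ≤ Real.exp (-1 * (3 * m)) * Real.exp ((Real.exp 1 - 1) * ∑ e ∈ F, (P e : ℝ)) := by
        gcongr
        exact mgf_successCount_le P F 1
    _ ≤ Real.exp (-1 * (3 * m)) * Real.exp ((Real.exp 1 - 1) * m) := by
        gcongr
        linarith [Real.exp_one_gt_d9]
    _ ≤ Real.exp (-m) := by
        rw [← Real.exp_add, Real.exp_le_exp]
        nlinarith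

end Chernoff

section Model

section Edges

variable {V : Type*} [Fintype V] [DecidableEq V]

/-- The unordered pairs that contain `v`; the loop at `v` is one of them. -/
def incidentPairs (v : V) : Finset (Sym2 V) := Finset.univ.image fun w => s(v, w)

/-- The unordered pairs with one element in `S` and the other one outside. -/
def cutPairs (S : Finset V) : Finset (Sym2 V) := (S ×ˢ Sᶜ).image fun z => s(z.1, z.2)

lemma sum_incidentPairs (F : Sym2 V → ℝ) (v : V) :
    ∑ e ∈ incidentPairs v, F e = ∑ w, F s(v, w) :=
  Finset.sum_image fun _ _ _ _ h => Sym2.congr_right.1 h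

lemma sum_cutPairs (F : Sym2 V → ℝ) (S : Finset V) :
    ∑ e ∈ cutPairs S, F e = ∑ v ∈ S, ∑ w ∈ Sᶜ, F s(v, w) := by
  rw [cutPairs, Finset.sum_image, Finset.sum_product]
  rintro ⟨v, w⟩ hvw ⟨v', w'⟩ hvw' heq
  rw [Finset.mem_coe, Finset.mem_product, Finset.mem_compl] at hvw hvw'
  rcases Sym2.eq_iff.1 heq with ⟨hv, hw⟩ | ⟨(hv : v = w'), -⟩
  · exact Prod.ext hv hw
  · exact absurd (hv ▸ hvw.1) hvw'.2

lemma successCount_incidentPairs (ε : Sym2 V → Bool) (v : V) :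
    successCount (incidentPairs v) ε = degree ε v :=
  (sum_incidentPairs _ v).trans (weightedDegree_adjacency ε v)

lemma successCount_cutPairs (ε : Sym2 V → Bool) (S : Finset V) :
    successCount (cutPairs S) ε = cutWeight (adjacency ε) S :=
  sum_cutPairs _ S

end Edges

/-- The expected number of neighbours of a vertex outside its own block. -/
def crossDegree (M n : ℕ) (q : unitInterval) : ℝ := ((M : ℝ) - 1) * n * q

variable {M n : ℕ} {p : Fin M → unitInterval} {q : unitInterval}

lemma crossDegree_nonneg (hM : 1 ≤ M) (n : ℕ) (q : unitInterval) : 0 ≤ crossDegree M n q :=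
  mul_nonneg (mul_nonneg (sub_nonneg.2 (by exact_mod_cast hM)) n.cast_nonneg) q.2.1

lemma crossDegree_le_expDegree (m : Fin M) : crossDegree M n q ≤ expDegree n p q m :=
  le_add_of_nonneg_left (mul_nonneg n.cast_nonneg (p m).2.1)

instance : IsProbabilityMeasure (law n p q) :=
  inferInstanceAs (IsProbabilityMeasure (bernoulliProduct (edgeProb p q)))

lemma card_filter_block (m : Fin M) : #{w : Vertex M n | w.1 = m} = n := by
  rw [Finset.card_filter, Fintype.sum_prod_type, Finset.sum_comm]
  simp

lemma sum_edgeProb (v : Vertex M n) :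
    ∑ w, (edgeProb p q s(v, w) : ℝ) = expDegree n p q v.1 := by
  have hprob (w : Vertex M n) : (edgeProb p q s(v, w) : ℝ)
      = q + if w.1 = v.1 then (p v.1 : ℝ) - q else 0 := by
    by_cases hvw : v.1 = w.1
    · simp [edgeProb, hvw]
    · simp [edgeProb, hvw, Ne.symm hvw]
  simp only [hprob, Finset.sum_add_distrib, Finset.sum_ite, Finset.sum_const, card_filter_block,
    Finset.card_univ, Fintype.card_prod, Fintype.card_fin, nsmul_eq_mul, Nat.cast_mul, mul_zero,
    expDegree]
  ring

lemma measureReal_degree_ge_le (v : Vertex M n) {G : ℝ} (hG : expDegree n p q v.1 ≤ G) :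
    (law n p q).real {ε | 3 * G ≤ degree ε v} ≤ Real.exp (-G) := by
  rw [← sum_edgeProb, ← sum_incidentPairs (fun e => (edgeProb p q e : ℝ))] at hG
  have htail := measureReal_three_mul_le_successCount_le _ _ hG
  simp only [successCount_incidentPairs] at htail
  exact htail

lemma sq_card_le_card_mul_sum_card_fiber {α ι : Type*} [Fintype ι] [DecidableEq ι] (f : α → ι)
    (S : Finset α) : #S ^ 2 ≤ Fintype.card ι * ∑ v ∈ S, #{w ∈ S | f w = f v} := by
  have hcard : #S = ∑ i, #{w ∈ S | f w = i} :=
    Finset.card_eq_sum_card_fiberwise fun v _ => Finset.mem_univ (f v)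
  have hsq : ∑ v ∈ S, #{w ∈ S | f w = f v} = ∑ i, #{w ∈ S | f w = i} ^ 2 := by
    rw [← Finset.sum_fiberwise S f]
    refine Finset.sum_congr rfl fun i _ => ?_
    rw [Finset.sum_congr rfl fun v hv => by rw [(Finset.mem_filter.1 hv).2], Finset.sum_const,
      smul_eq_mul, sq]
  rw [hcard, hsq]
  exact sq_sum_le_card_mul_sum_sq

lemma card_filter_compl_ne_block (S : Finset (Vertex M n)) (v : Vertex M n) :
    (#{w ∈ Sᶜ | w.1 ≠ v.1} : ℝ) = ((M : ℝ) - 1) * n - #S + #{w ∈ S | w.1 = v.1} := by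
  have hblock := Finset.univ.card_filter_add_card_filter_not fun w : Vertex M n => w.1 = v.1
  have hS := S.card_filter_add_card_filter_not fun w => w.1 = v.1
  have hsplit := S.sum_add_sum_compl fun w => if w.1 ≠ v.1 then 1 else 0
  simp only [← Finset.card_filter] at hsplit
  rw [card_filter_block, Finset.card_univ, Fintype.card_prod, Fintype.card_fin,
    Fintype.card_fin] at hblock
  rify at hblock hS hsplit
  linarith

lemma crossDegree_mul_card_le_sum_cut (S : Finset (Vertex M n)) (hS : 2 * #S ≤ M * n) :
    crossDegree M n q * #S / 2 ≤ ∑ v ∈ S, ∑ w ∈ Sᶜ, (edgeProb p q s(v, w) : ℝ) := by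
  rcases Nat.eq_zero_or_pos M with rfl | hM
  · simp [Finset.eq_empty_of_isEmpty S]
  have hM : (1 : ℝ) ≤ M := by exact_mod_cast hM
  have hS : 2 * (#S : ℝ) ≤ M * n := by exact_mod_cast hS
  have hsame : (#S : ℝ) ^ 2 ≤ M * ∑ v ∈ S, (#{w ∈ S | w.1 = v.1} : ℝ) := by
    exact_mod_cast Fintype.card_fin M ▸ sq_card_le_card_mul_sum_card_fiber Prod.fst S
  have hcross : ((M : ℝ) - 1) * n * #S / 2 ≤ ∑ v ∈ S, (#{w ∈ Sᶜ | w.1 ≠ v.1} : ℝ) := by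
    simp only [card_filter_compl_ne_block, Finset.sum_add_distrib, Finset.sum_const, nsmul_eq_mul]
    have hhalf : 0 ≤ #S * ((M : ℝ) - 1) * (M * n - 2 * #S) :=
      mul_nonneg (mul_nonneg (Nat.cast_nonneg _) (by linarith)) (by linarith)
    refine le_of_mul_le_mul_left ?_ (one_pos.trans_le hM)
    nlinarith
  calc crossDegree M n q * #S / 2
      = q * (((M : ℝ) - 1) * n * #S / 2) := by rw [crossDegree]; ring
    _ ≤ q * ∑ v ∈ S, (#{w ∈ Sᶜ | w.1 ≠ v.1} : ℝ) := mul_le_mul_of_nonneg_left hcross q.2.1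
    _ ≤ ∑ v ∈ S, ∑ w ∈ Sᶜ, (edgeProb p q s(v, w) : ℝ) := by
      rw [Finset.mul_sum]
      refine Finset.sum_le_sum fun v _ => ?_
      rw [mul_comm, ← nsmul_eq_mul, ← Finset.sum_const, Finset.sum_filter]
      refine Finset.sum_le_sum fun w _ => ?_
      by_cases hvw : v.1 = w.1
      · simpa [edgeProb, hvw] using (p w.1).2.1
      · simp [edgeProb, hvw, Ne.symm hvw]

lemma measureReal_cutWeight_le (S : Finset (Vertex M n)) (hS : 2 * #S ≤ M * n) :
    (law n p q).real {ε | cutWeight (adjacency ε) S ≤ crossDegree M n q / 4 * #S}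
      ≤ Real.exp (-crossDegree M n q / 20) ^ #S := by
  have hmean : crossDegree M n q * #S / 2 ≤ ∑ e ∈ cutPairs S, (edgeProb p q e : ℝ) := by
    rw [sum_cutPairs fun e => (edgeProb p q e : ℝ)]
    exact crossDegree_mul_card_le_sum_cut S hS
  have htail := measureReal_successCount_le_half_le _ _ hmean
  simp only [successCount_cutPairs] at htail
  have hthreshold : crossDegree M n q * #S / 2 / 2 = crossDegree M n q / 4 * #S := by ring
  have hexponent : -(crossDegree M n q * #S / 2) / 10 = #S * (-crossDegree M n q / 20) := by ring
  rw [hthreshold, hexponent, Real.exp_nat_mul] at htail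
  exact htail

lemma sum_pow_card_nonempty_le {V : Type*} [Fintype V] {x : ℝ} (hx₀ : 0 ≤ x)
    (hx : Fintype.card V * x ≤ 1) :
    ∑ S : Finset V with S.Nonempty, x ^ #S ≤ 2 * (Fintype.card V * x) := by
  classical
  have hall : ∑ S : Finset V, x ^ #S = (1 + x) ^ Fintype.card V := by
    simpa [add_comm] using Fintype.sum_pow_mul_eq_add_pow V x 1
  have hnonempty : ({S | S.Nonempty} : Finset (Finset V)) = Finset.univ.erase ∅ := by
    ext S
    simp [Finset.nonempty_iff_ne_empty]
  have hx₀' : 0 ≤ Fintype.card V * x := by positivity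
  calc ∑ S : Finset V with S.Nonempty, x ^ #S
      = (1 + x) ^ Fintype.card V - 1 := by
        rw [hnonempty, Finset.sum_erase_eq_sub (Finset.mem_univ ∅), hall, Finset.card_empty,
          pow_zero]
    _ ≤ Real.exp (Fintype.card V * x) - 1 := by
        rw [Real.exp_nat_mul]
        gcongr
        linarith [Real.add_one_le_exp x]
    _ ≤ 2 * (Fintype.card V * x) := by
        have hexp := Real.abs_exp_sub_one_le ((abs_of_nonneg hx₀').trans_le hx)
        rw [abs_of_nonneg hx₀'] at hexp
        exact (le_abs_self _).trans hexp

lemma measureReal_not_isExpanding_le {x : ℝ} (hx : Real.exp (-crossDegree M n q / 20) ≤ x)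
    (hNx : M * n * x ≤ 1) :
    (law n p q).real {ε | ¬ IsExpanding (adjacency ε) (crossDegree M n q / 4)}
      ≤ 2 * (M * n * x) := by
  have hcard : Fintype.card (Vertex M n) = M * n := by simp
  have hx₀ : 0 ≤ x := (Real.exp_pos _).le.trans hx
  have hsub : {ε : Sym2 (Vertex M n) → Bool | ¬ IsExpanding (adjacency ε) (crossDegree M n q / 4)}
      ⊆ ⋃ S ∈ ({S | S.Nonempty ∧ 2 * #S ≤ M * n} : Finset (Finset (Vertex M n))),
        {ε | cutWeight (adjacency ε) S ≤ crossDegree M n q / 4 * #S} := by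
    intro ε hε
    simp only [IsExpanding, Set.mem_ofPred_eq, not_forall, not_le, hcard] at hε
    obtain ⟨S, hS, hcut⟩ := hε
    have hne : S.Nonempty := by
      rw [Finset.nonempty_iff_ne_empty]
      rintro rfl
      simp [cutWeight] at hcut
    exact Set.mem_biUnion (by simp [hne, hS]) hcut.le
  calc (law n p q).real {ε | ¬ IsExpanding (adjacency ε) (crossDegree M n q / 4)}
      ≤ ∑ S : Finset (Vertex M n) with S.Nonempty ∧ 2 * #S ≤ M * n,
          (law n p q).real {ε | cutWeight (adjacency ε) S ≤ crossDegree M n q / 4 * #S} :=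
        (measureReal_mono hsub (measure_ne_top _ _)).trans (measureReal_biUnion_finset_le _ _)
    _ ≤ ∑ S : Finset (Vertex M n) with S.Nonempty ∧ 2 * #S ≤ M * n, x ^ #S := by
        gcongr with S hS
        exact (measureReal_cutWeight_le S (Finset.mem_filter.1 hS).2.2).trans (by gcongr)
    _ ≤ ∑ S : Finset (Vertex M n) with S.Nonempty, x ^ #S :=
        Finset.sum_le_sum_of_subset_of_nonneg
          (Finset.monotone_filter_right _ fun _ _ h => h.1) fun _ _ _ => by positivity
    _ ≤ 2 * (M * n * x) := by
        have hsum := sum_pow_card_nonempty_le (V := Vertex M n) hx₀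
        rw [hcard, Nat.cast_mul] at hsum
        exact hsum hNx

lemma measureReal_exists_degree_ge_le {G : ℝ} (hG : ∀ m, expDegree n p q m ≤ G) :
    (law n p q).real {ε | ∃ v, 3 * G ≤ degree ε v} ≤ M * n * Real.exp (-G) := by
  rw [Set.ofPred_exists]
  refine (measureReal_iUnion_fintype_le _).trans ?_
  refine (Finset.sum_le_card_nsmul _ _ _ fun v _ => measureReal_degree_ge_le v (hG v.1)).trans_eq ?_
  simp

lemma measureReal_not_expanding_le (hN : 0 < M * n) {G : ℝ} (hG : ∀ m, expDegree n p q m ≤ G)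
    (hc : 40 * Real.log (M * n) ≤ crossDegree M n q) :
    (law n p q).real {ε | ¬ (IsExpanding (adjacency ε) (crossDegree M n q / 4) ∧
      ∀ v, degree ε v ≤ 3 * G)} ≤ 3 / (M * n) := by
  have hN₁ : (1 : ℝ) ≤ M * n := by exact_mod_cast hN
  have hN₀ : (0 : ℝ) < M * n := one_pos.trans_le hN₁
  have hlog : 0 ≤ Real.log (M * n) := Real.log_nonneg hN₁
  have hexp {y : ℝ} (hy : 2 * Real.log (M * n) ≤ y) : Real.exp (-y) ≤ 1 / (M * n : ℝ) ^ 2 := by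
    rw [Real.exp_neg, ← one_div, ← Real.exp_log (pow_pos hN₀ 2), Real.log_pow]
    gcongr
    exact_mod_cast hy
  have hcG : crossDegree M n q ≤ G :=
    (crossDegree_le_expDegree ⟨0, Nat.pos_of_mul_pos_right hN⟩).trans (hG _)
  have hNx : M * n * (1 / (M * n : ℝ) ^ 2) = 1 / (M * n) := by field_simp
  have hsub : {ε : Sym2 (Vertex M n) → Bool | ¬ (IsExpanding (adjacency ε) (crossDegree M n q / 4) ∧
      ∀ v, degree ε v ≤ 3 * G)}
      ⊆ {ε | ¬ IsExpanding (adjacency ε) (crossDegree M n q / 4)}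
        ∪ {ε | ∃ v, 3 * G ≤ degree ε v} := by
    intro ε hε
    rcases not_and_or.1 hε with hε | hε
    · exact Or.inl hε
    · push Not at hε
      exact Or.inr (hε.imp fun v => le_of_lt)
  calc _ ≤ _ := (measureReal_mono hsub).trans (measureReal_union_le _ _)
    _ ≤ 2 * (M * n * (1 / (M * n : ℝ) ^ 2)) + M * n * (1 / (M * n : ℝ) ^ 2) := by
        gcongr
        · refine measureReal_not_isExpanding_le ?_ (by rw [hNx]; exact div_le_one_of_le₀ hN₁ hN₀.le)
          rw [neg_div]
          exact hexp (by linarith)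
        · exact (measureReal_exists_degree_ge_le hG).trans (by gcongr; exact hexp (by linarith))
    _ = 3 / (M * n) := by rw [hNx]; ring

end Model

section Asymptotics

lemma mul_sq_le_pow_three_of_le {a b c C L K : ℝ} (ha : 0 ≤ a) (hab : a ≤ b) (hc : 0 ≤ c)
    (hC : 1 ≤ C) (hL : 1 ≤ L) (hK : 1 ≤ K)
    (hconn : 128 * K ^ 2 * C * (L * (b + c) ^ 2) ≤ (a + c) ^ 3)
    (hcross : L * a ^ 5 * b ^ 2 ≤ C * c ^ 8) : K * L * (b + c) ^ 2 ≤ c ^ 3 := by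
  have hb : 0 ≤ b := ha.trans hab
  rcases le_or_gt a c with hac | hac
  · have hsum : (a + c) ^ 3 ≤ (2 * c) ^ 3 := by gcongr; linarith
    have hKC : K ≤ K ^ 2 * C :=
      (le_self_pow₀ hK two_ne_zero).trans (le_mul_of_one_le_right (sq_nonneg K) hC)
    have hle : K * (L * (b + c) ^ 2) ≤ K ^ 2 * C * (L * (b + c) ^ 2) := by gcongr
    have hc₃ : 0 ≤ c ^ 3 := by positivity
    linarith
  · have hsum : (a + c) ^ 3 ≤ (2 * a) ^ 3 := by gcongr; linarith
    have hle : b ^ 2 ≤ (b + c) ^ 2 := by gcongr; linarith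
    have ha₃ : (4 * K) ^ 2 * C * (L * b ^ 2) ≤ a ^ 3 := by
      have : 128 * K ^ 2 * C * (L * b ^ 2) ≤ 128 * K ^ 2 * C * (L * (b + c) ^ 2) := by gcongr
      linarith
    have hpow : C ^ 3 * (4 * K * L * b ^ 2) ^ 8 ≤ C ^ 3 * (c ^ 3) ^ 8 := by
      calc C ^ 3 * (4 * K * L * b ^ 2) ^ 8 = (4 * K) ^ 8 * C ^ 3 * L ^ 8 * b ^ 16 := by ring
        _ ≤ (4 * K) ^ 10 * C ^ 5 * L ^ 8 * b ^ 16 := by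
            gcongr
            · linarith
            · norm_num
            · norm_num
        _ = L ^ 3 * ((4 * K) ^ 2 * C * (L * b ^ 2)) ^ 5 * b ^ 6 := by ring
        _ ≤ L ^ 3 * (a ^ 3) ^ 5 * b ^ 6 := by gcongr
        _ = (L * a ^ 5 * b ^ 2) ^ 3 := by ring
        _ ≤ (C * c ^ 8) ^ 3 := by gcongr
        _ = C ^ 3 * (c ^ 3) ^ 8 := by ring
    have hroot : 4 * K * L * b ^ 2 ≤ c ^ 3 :=
      le_of_pow_le_pow_left₀ (by norm_num) (by positivity)
        (le_of_mul_le_mul_left hpow (by positivity))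
    calc K * L * (b + c) ^ 2 ≤ K * L * (2 * b) ^ 2 := by gcongr; linarith
      _ = 4 * K * L * b ^ 2 := by ring
      _ ≤ c ^ 3 := hroot

lemma mul_pow_mul_pow_le_of_rpow_le {n L x y C Q : ℝ} (hn : 0 < n) (hL : 0 ≤ L) (hx : 0 ≤ x)
    (hy : 0 ≤ y)
    (h : (L / n) ^ (1 / 4 : ℝ) * x ^ (5 / 4 : ℝ) * y ^ (1 / 2 : ℝ) ≤ C * Q ^ 2) :
    L * (n * x) ^ 5 * (n * y) ^ 2 ≤ C ^ 4 * (n * Q) ^ 8 := by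
  have hrpow {z r : ℝ} {j : ℕ} (hz : 0 ≤ z) (hrj : r * 4 = j) : (z ^ r) ^ 4 = z ^ j := by
    rw [← Real.rpow_natCast, ← Real.rpow_mul hz, ← Real.rpow_natCast z j, ← hrj, Nat.cast_ofNat]
  have hpow := pow_le_pow_left₀ (by positivity) h 4
  rw [mul_pow, mul_pow, hrpow (j := 1) (by positivity) (by norm_num),
    hrpow (j := 5) hx (by norm_num), hrpow (j := 2) hy (by norm_num), pow_one] at hpow
  calc L * (n * x) ^ 5 * (n * y) ^ 2 = n ^ 8 * (L / n * x ^ 5 * y ^ 2) := by field_simp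
    _ ≤ n ^ 8 * (C * Q ^ 2) ^ 4 := by gcongr
    _ = C ^ 4 * (n * Q) ^ 8 := by ring

variable {M n N : ℕ} {p : Fin M → unitInterval} {q : unitInterval}

lemma iInf_expDegree [Nonempty (Fin M)] :
    ⨅ m, expDegree n p q m = n * (⨅ m, (p m : ℝ)) + crossDegree M n q := by
  rw [Real.mul_iInf_of_nonneg n.cast_nonneg, ciInf_add (Set.finite_range _).bddBelow]
  rfl

lemma iSup_expDegree [Nonempty (Fin M)] :
    ⨆ m, expDegree n p q m = n * (⨆ m, (p m : ℝ)) + crossDegree M n q := by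
  rw [Real.mul_iSup_of_nonneg n.cast_nonneg, ciSup_add (Set.finite_range _).bddAbove]
  rfl

lemma mul_log_mul_sq_iSup_expDegree_le {K C : ℝ} {r : ℕ} (hr : r ≠ 0) (hK : 1 ≤ K) (hC : 1 ≤ C)
    (hN : N = M * n) (hlog : 1 ≤ Real.log N) (hpos : ∀ m, 0 < expDegree n p q m)
    {i : Fin M} (hi : (p i : ℝ) = ⨅ m, (p m : ℝ))
    (hconn : M * Real.log N ^ r / (N * (p i : ℝ) + N * ((M : ℝ) - 1) * q)
      * ((⨆ m, expDegree n p q m) ^ 2 / (⨅ m, expDegree n p q m) ^ 2) ≤ 1 / (128 * K ^ 2 * C ^ 4))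
    (hq : (M * Real.log N / N) ^ (1 / 4 : ℝ) * (⨅ m, (p m : ℝ)) ^ (5 / 4 : ℝ)
      * (⨆ m, (p m : ℝ)) ^ (1 / 2 : ℝ) ≤ C * (((M : ℝ) - 1) * q) ^ 2) :
    K * Real.log N * (⨆ m, expDegree n p q m) ^ 2 ≤ crossDegree M n q ^ 3 := by
  have : Nonempty (Fin M) := ⟨i⟩
  have hM : 0 < M := i.pos
  have hn : 0 < n := Nat.pos_of_ne_zero fun h => by simp [hN, h] at hlog; linarith
  have hM' : (0 : ℝ) < M := by exact_mod_cast hM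
  have hn' : (0 : ℝ) < n := by exact_mod_cast hn
  have hN' : (N : ℝ) = M * n := by exact_mod_cast hN
  have hsup : p i ≤ ⨆ m, (p m : ℝ) :=
    le_ciSup (f := fun m => (p m : ℝ)) (Set.finite_range _).bddAbove i
  have hdeg : 0 < n * (p i : ℝ) + crossDegree M n q := hpos i
  have hden : N * (p i : ℝ) + N * ((M : ℝ) - 1) * q
      = M * (n * (p i : ℝ) + crossDegree M n q) := by
    rw [hN', crossDegree]
    ring
  rw [iSup_expDegree, iInf_expDegree, ← hi, hden, mul_div_mul_left _ _ hM'.ne',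
    ← mul_div_mul_comm, ← pow_succ', div_le_div_iff₀ (by positivity) (by positivity),
    one_mul] at hconn
  rw [hN', mul_div_mul_left _ _ hM'.ne', ← hN', ← hi] at hq
  have hcross := mul_pow_mul_pow_le_of_rpow_le hn' (by linarith) (p i).2.1
    ((p i).2.1.trans hsup) hq
  have hcrossDegree : n * (((M : ℝ) - 1) * q) = crossDegree M n q := by
    rw [crossDegree]
    ring
  rw [hcrossDegree] at hcross
  rw [iSup_expDegree]
  refine mul_sq_le_pow_three_of_le (mul_nonneg hn'.le (p i).2.1) (by gcongr)
    (crossDegree_nonneg hM n q) (one_le_pow₀ hC) hlog hK (le_trans ?_ hconn) hcross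
  rw [mul_comm]
  gcongr
  exact le_self_pow₀ hlog hr

lemma pos_and_le_of_mul_sq_le_pow_three {x c G : ℝ} (hx : 0 < x) (hG : 0 < G) (hcG : c ≤ G)
    (h : x * G ^ 2 ≤ c ^ 3) : 0 < c ∧ x ≤ c := by
  have hc : 0 < c :=
    (Odd.pow_pos_iff (by decide : Odd 3)).1 ((mul_pos hx (pow_pos hG 2)).trans_le h)
  refine ⟨hc, le_of_mul_le_mul_right ?_ (pow_pos hc 2)⟩
  calc x * c ^ 2 ≤ x * G ^ 2 := by gcongr
    _ ≤ c * c ^ 2 := h.trans_eq (pow_succ' c 2)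

lemma avgHittingTime_error_le {K G c δ : ℝ} (hδ : 0 < δ) (hK : 0 < K) (hKδ : 1156 / δ ≤ K)
    (hc : 0 < c) (hKc : K ≤ c) (hKG : K * G ^ 2 ≤ c ^ 3) :
    1 / (c / 4) + 2 * (3 * G) ^ 2 / (c / 4) ^ 3 ≤ δ := by
  have hfst : 1 / (c / 4) ≤ 4 / K := by
    rw [one_div_div]
    gcongr
  have hsnd : 2 * (3 * G) ^ 2 / (c / 4) ^ 3 ≤ 1152 / K := by
    rw [div_le_div_iff₀ (by positivity) hK]
    linarith
  calc 1 / (c / 4) + 2 * (3 * G) ^ 2 / (c / 4) ^ 3 ≤ 4 / K + 1152 / K := add_le_add hfst hsnd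
    _ = 1156 / K := by rw [← add_div]; norm_num
    _ ≤ δ := (div_le_comm₀ hδ hK).1 hKδ

lemma one_sub_le_measureReal_avgHittingTime {G δ : ℝ} (hN : N = M * n) (hlog : 1 ≤ Real.log N)
    (hδ : 0 < δ) (hδN : 2 / δ ≤ N) (hG₀ : 0 < G) (hG : ∀ m, expDegree n p q m ≤ G)
    (hcG : (40 + 1156 / δ) * Real.log N * G ^ 2 ≤ crossDegree M n q ^ 3) :
    1 - 3 / N ≤ (law n p q).real {ε | IsConnected ε ∧ ∀ v,
      ENNReal.ofReal ((1 - δ) * N) ≤ avgHittingTime ε v ∧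
      avgHittingTime ε v ≤ ENNReal.ofReal ((1 + δ) * N)} := by
  have hK : 40 ≤ 40 + 1156 / δ := le_add_of_nonneg_right (by positivity)
  have hN₀ : 0 < N := Nat.pos_of_ne_zero fun h => by simp [h] at hlog; linarith
  have hN₂ : 2 ≤ N := by
    have : (2 : ℝ) ≤ N := by
      linarith [Real.log_le_sub_one_of_pos (Nat.cast_pos (α := ℝ).2 hN₀)]
    exact_mod_cast this
  have hN' : (N : ℝ) = M * n := by exact_mod_cast hN
  have hcard : Fintype.card (Vertex M n) = N := by simp [hN]
  have : Nonempty (Vertex M n) := Fintype.card_pos_iff.1 (hcard ▸ hN₀)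
  have hle : crossDegree M n q ≤ G :=
    (crossDegree_le_expDegree ⟨0, Nat.pos_of_mul_pos_right (hN ▸ hN₀)⟩).trans (hG _)
  obtain ⟨hc, hKc⟩ := pos_and_le_of_mul_sq_le_pow_three (by positivity) hG₀ hle hcG
  set K := 40 + 1156 / δ
  have hKK : K ≤ K * Real.log N := le_mul_of_one_le_right (by positivity) hlog
  have hgood : (law n p q).real {ε | IsExpanding (adjacency ε) (crossDegree M n q / 4) ∧
      ∀ v, degree ε v ≤ 3 * G}ᶜ ≤ 3 / N := by
    rw [hN']
    refine measureReal_not_expanding_le (hN ▸ hN₀) hG ?_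
    rw [← hN']
    exact (by gcongr : 40 * Real.log N ≤ K * Real.log N).trans hKc
  rw [probReal_compl_eq_one_sub (Set.toFinite _).measurableSet, sub_le_comm] at hgood
  refine hgood.trans (measureReal_mono ?_ (measure_ne_top _ _))
  rintro ε ⟨hexp, hdeg⟩
  refine ⟨hexp.isConnected (by positivity), ?_⟩
  have hmem := hexp.avgHittingTime_mem_Icc_mul (by positivity) (by rwa [hcard]) hdeg
    (by rwa [hcard, ← div_le_iff₀' hδ])
    (avgHittingTime_error_le hδ (by positivity) (le_add_of_nonneg_left (by norm_num)) hc
      (hKK.trans hKc) ((by gcongr : K * G ^ 2 ≤ K * Real.log N * G ^ 2).trans hcG))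
  rwa [hcard] at hmem

end Asymptotics

end SBM

theorem theorem1p1_general {r : ℕ} (hr : r ≠ 0) (M n N : ℕ → ℕ) (hM : ∀ k, 1 ≤ M k)
    (hN : ∀ k, N k = M k * n k) (hN_top : Tendsto N atTop atTop)
    (p : (k : ℕ) → Fin (M k) → unitInterval) (q : ℕ → unitInterval)
    (hpos : ∀ᶠ k in atTop, ∀ m, 0 < SBM.expDegree (n k) (p k) (q k) m)
    (hconn : ∀ m : (k : ℕ) → Fin (M k), Tendsto (fun k =>
        (M k : ℝ) * Real.log (N k) ^ r /
            ((N k : ℝ) * (p k (m k) : ℝ) + (N k : ℝ) * ((M k : ℝ) - 1) * (q k : ℝ))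
          * ((⨆ i, SBM.expDegree (n k) (p k) (q k) i) ^ 2
            / (⨅ i, SBM.expDegree (n k) (p k) (q k) i) ^ 2)) atTop (𝓝 0))
    (hq : (fun k => ((M k : ℝ) * Real.log (N k) / (N k : ℝ)) ^ (1 / 4 : ℝ)
          * (⨅ i, (p k i : ℝ)) ^ (5 / 4 : ℝ) * (⨆ i, (p k i : ℝ)) ^ (1 / 2 : ℝ))
        =O[atTop] fun k => (((M k : ℝ) - 1) * (q k : ℝ)) ^ 2) (δ : ℝ) (hδ : 0 < δ) :
    Tendsto (fun k => SBM.law (n k) (p k) (q k)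
        {ε | SBM.IsConnected ε ∧ ∀ v,
          ENNReal.ofReal ((1 - δ) * N k) ≤ SBM.avgHittingTime ε v ∧
          SBM.avgHittingTime ε v ≤ ENNReal.ofReal ((1 + δ) * N k)}) atTop (𝓝 1) := by
  have hne (k : ℕ) : Nonempty (Fin (M k)) := ⟨⟨0, hM k⟩⟩
  have hNR : Tendsto (fun k => (N k : ℝ)) atTop atTop := tendsto_natCast_atTop_atTop.comp hN_top
  choose i hi using fun k => exists_eq_ciInf_of_finite (f := fun m => (p k m : ℝ))
  obtain ⟨C, hqC, hC⟩ :=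
    ((isBigO_iff_eventually.1 hq).and (eventually_ge_atTop (1 : ℝ))).exists
  have hK : (1 : ℝ) ≤ 40 + 1156 / δ := by linarith [div_pos (by norm_num : (0 : ℝ) < 1156) hδ]
  have hconnK := (hconn i).eventually_le_const
    (show (0 : ℝ) < 1 / (128 * (40 + 1156 / δ) ^ 2 * C ^ 4) by positivity)
  rw [← ENNReal.tendsto_toReal_iff (fun _ => measure_ne_top _ _) ENNReal.one_ne_top]
  refine tendsto_of_tendsto_of_tendsto_of_le_of_le'
    (by simpa using (hNR.const_div_atTop 3).const_sub 1) tendsto_const_nhds ?_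
    (Eventually.of_forall fun _ => measureReal_le_one)
  filter_upwards [hconnK, hqC, hpos, (Real.tendsto_log_atTop.comp hNR).eventually_ge_atTop 1,
    hNR.eventually_ge_atTop (2 / δ)] with k hconnK hqC hpos hlog hNδ
  rw [Real.norm_of_nonneg (sq_nonneg _)] at hqC
  have hdeg_le := le_ciSup (Set.finite_range (SBM.expDegree (n k) (p k) (q k))).bddAbove
  exact SBM.one_sub_le_measureReal_avgHittingTime (hN k) hlog hδ hNδ
    ((hpos (i k)).trans_le (hdeg_le _)) hdeg_le
    (SBM.mul_log_mul_sq_iSup_expDegree_le hr hK hC (hN k) hlog hpos (hi k) hconnK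
      ((le_abs_self _).trans hqC))

theorem theorem1p1
    -- number of blocks, block size, number of vertices of the `k`-th model
    (M n N : ℕ → ℕ) (hM : ∀ k, 1 ≤ M k) (hN : ∀ k, N k = M k * n k)
    -- `N → ∞` and `M = o(N)`; for a constant number of blocks this just says `N → ∞`
    (hN_top : Tendsto N atTop atTop)
    (hMN : (fun k => (M k : ℝ)) =o[atTop] fun k => (N k : ℝ))
    -- edge probabilities
    (p : (k : ℕ) → Fin (M k) → unitInterval) (q : ℕ → unitInterval)
    -- the expected degrees are positive for large `k`, so that the quotients below make sense
    (hpos : ∀ᶠ k in atTop, ∀ m, 0 < SBM.expDegree (n k) (p k) (q k) m)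
    -- connectivity condition
    (hconn : ∀ m : (k : ℕ) → Fin (M k), Tendsto (fun k =>
        (M k : ℝ) * Real.log (N k) ^ 4 /
            ((N k : ℝ) * (p k (m k) : ℝ) + (N k : ℝ) * ((M k : ℝ) - 1) * (q k : ℝ))
          * ((⨆ i, SBM.expDegree (n k) (p k) (q k) i) ^ 2
            / (⨅ i, SBM.expDegree (n k) (p k) (q k) i) ^ 2)) atTop (𝓝 0))
    -- lower bound on `q`
    (hq : (fun k => ((M k : ℝ) * Real.log (N k) / (N k : ℝ)) ^ (1 / 4 : ℝ)
          * (⨅ i, (p k i : ℝ)) ^ (5 / 4 : ℝ) * (⨆ i, (p k i : ℝ)) ^ (1 / 2 : ℝ))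
        =o[atTop] fun k => (((M k : ℝ) - 1) * (q k : ℝ)) ^ 2) :
    ∀ δ : ℝ, 0 < δ → Tendsto (fun k => SBM.law (n k) (p k) (q k)
        {ε | SBM.IsConnected ε ∧ ∀ v,
          ENNReal.ofReal ((1 - δ) * N k) ≤ SBM.avgHittingTime ε v ∧
          SBM.avgHittingTime ε v ≤ ENNReal.ofReal ((1 + δ) * N k)}) atTop (𝓝 1) :=
  theorem1p1_general four_ne_zero M n N hM hN hN_top p q hpos hconn hq.isBigO
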